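/- **Theorem (first convergence result).** Let $\mathcal H$ be a real Hilbert space and let $f:\mathcal H\to\mathbb R\cup\{+\infty\}$ be proper, convex and lower semicontinuous with $\operatorname{argmin} f\neq\emptyset$; put $f^*=\min f$. For $\gamma>0$ let $f_\gamma(x)=\min_{y\in\mathcal H}\{f(y)+\tfrac1{2\gamma}\|x-y\|^2\}$ be the Moreau envelope of $f$. Let $t_0>0$, $\alpha>3$, $\beta>0$, and let $\delta,\gamma:[t_0,+\infty)\to(0,+\infty)$ be $C^1$ functions such that 1. $\liminf_{t\to+\infty}\dfrac{\dot\gamma(t)}{t\,\delta(t)}>0$ (the value $+\infty$ being allowed); 2. $\dfrac{t\,\delta(t)}{\gamma(t)}=O(1/t)$ as $t\to+\infty$; 3. $\dfrac{\dot\gamma(t)}{\gamma(t)}=O(1/t)$ as $t\to+\infty$; 4. there is $\zeta$ with $0<\zeta\le\alpha-3$ such that $0\le \dfrac{t\,\dot\delta(t)}{\delta(t)}\le\alpha-3-\zeta$ for all sufficiently large $t$. Let $x:[t_0,+\infty)\to\mathcal H$ be a solution trajectory of $$\ddot x(t)+\frac{\alpha}{t}\dot x(t)+\beta\,\frac{\mathrm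 d}{\mathrm dt}\Big[\delta(t)\nabla f_{\gamma(t)}(x(t))\Big]+\Big(1+\frac{\beta}{t}\Big)\delta(t)\nabla f_{\gamma(t)}(x(t))=0 ,$$ that is, $x$ is differentiable on $[t_0,+\infty)$, $\dot x$ is locally absolutely continuous on $[t_0,+\infty)$, and for almost every $t\ge t_0$ the two derivatives $\ddot x(t)$ and $\frac{\mathrm d}{\mathrm dt}[\delta(t)\nabla f_{\gamma(t)}(x(t))]$ exist and the equation holds. Then, as $t\to+\infty$: (i) $f_{\gamma(t)}(x(t))-f^*=o\Big(\dfrac1{t^2\delta(t)}\Big)$; (ii) $\|\nabla f_{\gamma(t)}(x(t))\|=o\Big(\dfrac1{t^2\delta(t)}\Big)$; (iii) $\|\dot x(t)\|=o\Big(\dfrac1t\Big)$; (iv) $\displaystyle\int_{t_0}^{+\infty}t\,\|\dot x(t)\|^2\,\mathrm dt<+\infty$; (v) $\displaystyle\int_{t_0}^{+\infty}t^3\delta(t)^2\,\|\nabla f_{\gamma(t)}(x(t))\|^2\,\mathrm dt<+\infty$; (vi) if in addition $\liminf_{t\to+\infty}\dfrac{t^2\delta(t)}{\gamma(t)}>0$,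 then $x(t)$ converges weakly in $\mathcal H$ as $t\to+\infty$, and its weak limit belongs to $\operatorname{argmin} f$. -/

import Mathlib

open Set Filter Topology MeasureTheory Asymptotics

/-- `f : H → ℝ ∪ {+∞}` is proper, convex and lower semicontinuous. -/
structure IsProperConvexLsc {H : Type*} [NormedAddCommGroup H] [InnerProductSpace ℝ H]
    (f : H → EReal) : Prop where
  ne_bot : ∀ x, f x ≠ ⊥
  exists_ne_top : ∃ x, f x ≠ ⊤
  convex : ∀ x y : H, ∀ a b : ℝ, 0 ≤ a → 0 ≤ b → a + b = 1 →
    f (a • x + b • y) ≤ (a : EReal) * f x + (b : EReal) * f y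
  lsc : LowerSemicontinuous f

/-- The set of global minimizers of `f`. -/
def argminSet {H : Type*} (f : H → EReal) : Set H :=
  {x | ∀ y, f x ≤ f y}

/-- The minimal value of `f`, as a real number (it is finite as soon as `f` is proper and has a
minimizer). -/
noncomputable def minValue {H : Type*} (f : H → EReal) : ℝ :=
  (⨅ y, f y).toReal

/-- The Moreau envelope `f_γ(x) = inf_y (f y + ‖x - y‖² / (2γ))`, as a real number (for `γ > 0` it
is finite, and the infimum is attained, for every proper convex lower semicontinuous `f`). -/
noncomputable def moreauEnvelope {H : Type*} [NormedAddCommGroup H] [InnerProductSpace ℝ H]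
    (f : H → EReal) (γ : ℝ) (x : H) : ℝ :=
  (⨅ y, f y + ((1 / (2 * γ) * ‖x - y‖ ^ 2 : ℝ) : EReal)).toReal

/-- The assumption on the coefficients `α, β` and the functions `δ, γ : [t₀, ∞) → (0, ∞)`. The
lower limit is taken in the extended reals. -/
structure CoefficientAssumption (α β t₀ : ℝ) (δ γ : ℝ → ℝ) : Prop where
  three_lt : 3 < α
  beta_pos : 0 < β
  delta_pos : ∀ t ∈ Ici t₀, 0 < δ t
  gamma_pos : ∀ t ∈ Ici t₀, 0 < γ t
  delta_contDiff : ContDiffOn ℝ 1 δ (Ici t₀)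
  gamma_contDiff : ContDiffOn ℝ 1 γ (Ici t₀)
  liminf_pos :
    0 < liminf (fun t => ((derivWithin γ (Ici t₀) t / (t * δ t) : ℝ) : EReal)) atTop
  ratio_isBigO : (fun t => t * δ t / γ t) =O[atTop] fun t => 1 / t
  logDeriv_isBigO : (fun t => derivWithin γ (Ici t₀) t / γ t) =O[atTop] fun t => 1 / t
  growth : ∃ ζ : ℝ, 0 < ζ ∧ ζ ≤ α - 3 ∧
    ∀ᶠ t in atTop, 0 ≤ t * derivWithin δ (Ici t₀) t / δ t ∧
      t * derivWithin δ (Ici t₀) t / δ t ≤ α - 3 - ζ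

/-- The rescaled gradient `t ↦ δ(t) ∇f_{γ(t)}(x(t))` along a curve `x`. -/
noncomputable def rescaledGradient {H : Type*} [NormedAddCommGroup H] [InnerProductSpace ℝ H]
    [CompleteSpace H] (f : H → EReal) (δ γ : ℝ → ℝ) (x : ℝ → H) (t : ℝ) : H :=
  δ t • gradient (moreauEnvelope f (γ t)) (x t)

/-- `x : [t₀, ∞) → H` is a solution trajectory of
`ẍ + (α/t) ẋ + β d/dt[δ ∇f_γ(x)] + (1 + β/t) δ ∇f_γ(x) = 0`: it is differentiable, its velocity is
locally absolutely continuous on `[t₀, ∞)`, and for almost every `t ≥ t₀` the two time derivatives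
in the equation exist and the equation holds. The values of `x` at times before `t₀` are
irrelevant. -/
structure IsSolutionNSHR {H : Type*} [NormedAddCommGroup H] [InnerProductSpace ℝ H]
    [CompleteSpace H] (f : H → EReal) (α β t₀ : ℝ) (δ γ : ℝ → ℝ) (x : ℝ → H) : Prop where
  differentiableOn : DifferentiableOn ℝ x (Ici t₀)
  velocity_ac : ∀ T, t₀ ≤ T → AbsolutelyContinuousOnInterval (derivWithin x (Ici t₀)) t₀ T
  equation : ∀ᵐ t ∂(volume.restrict (Ici t₀)), ∃ acc g : H,
    HasDerivAt (derivWithin x (Ici t₀)) acc t ∧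
    HasDerivAt (rescaledGradient f δ γ x) g t ∧
    acc + (α / t) • derivWithin x (Ici t₀) t + β • g
      + (1 + β / t) • rescaledGradient f δ γ x t = 0

/-!
The trajectory is analysed through the variable `y = ẋ + β δ ∇f_γ(x)`. Along a solution `ẋ` and
`δ ∇f_γ(x)` are only absolutely continuous, but the equation says that `ẏ` agrees almost everywhere
with the continuous function `-(α/t) ẋ - (1 + β/t) δ ∇f_γ(x)`, so `y` is `C¹`
(`IsSolutionNSHR.hasDerivAt_velocity_add`). The envelope along the curve is `C¹` as well, with
derivative `⟪∇f_γ(x), ẋ⟫ - γ̇/2 ‖∇f_γ(x)‖²` (`hasDerivAt_moreauEnvelope`): it lies between two smooth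
functions of `(γ, x)` that touch it at the current point.

For a minimizer `z` and a small `ε > 0`, put `φ = f_γ(x) - f^*` and consider
`E_ε = (t² δ + β ε t δ) φ + ½ ‖(α-1-ε)(x - z) + t y‖² + (α-1-ε) ε/2 ‖x - z‖²`.
If `ε < ζ`, then eventually
`E_ε' ≤ -((ζ-ε)/2 t δ φ + ε t ‖ẋ‖² + c/2 t³ δ² ‖∇f_γ(x)‖²)`
(`IsDampedTrajectory.deriv_dampedEnergy_le`). The first term comes from convexity and the growth
condition on `δ`, the last one from `γ̇ ≥ c t δ`. Hence `E_ε` converges and the three terms on the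
right are integrable, which contains both integral estimates.

The energies for two values of `ε` differ, up to a multiple of `t δ φ → 0`, by a multiple of
`k = (α-1)/2 ‖x - z‖² + t ⟪x - z, y⟫`. So `k` converges, and then so does
`S = t² δ φ + t²/2 ‖y‖²`. Since `S / t` is integrable, the limit of `S` is `0`
(`IsDampedTrajectory.exists_tendsto_and_tendsto_zero`). This gives `t² δ φ → 0` and `t y → 0`; the
rate of the gradient follows from `γ/2 ‖∇f_γ(x)‖² ≤ φ` and the boundedness of `t² δ / γ`, and with
it the rate of `ẋ`.

For the weak convergence, `t y → 0` and the convergence of `k` show that `‖x - z‖` converges for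
every minimizer `z`. Opial's lemma reduces the claim to weak cluster points. Both `∇f_γ(x)` and
`γ ∇f_γ(x)` tend to `0` in norm, and monotonicity of the subdifferential of `f` forces every weak
cluster point to be a minimizer (`mem_argminSet_of_tendsto_inner`).
-/

/-! ### Proximal points and the Moreau envelope -/

section MoreauEnvelope

variable {H : Type*} [NormedAddCommGroup H] [InnerProductSpace ℝ H]

theorem IsProperConvexLsc.isClosed_realEpigraph {f : H → EReal} (hf : IsProperConvexLsc f) :
    IsClosed {q : H × ℝ | f q.1 ≤ (q.2 : EReal)} :=
  hf.lsc.isClosed_epigraph.preimage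
    (continuous_fst.prodMk (continuous_coe_real_ereal.comp continuous_snd))

theorem IsProperConvexLsc.le_coe_of_le_coe {f : H → EReal} (hf : IsProperConvexLsc f)
    {y y' : H} {s s' a b : ℝ} (hy : f y ≤ (s : EReal)) (hy' : f y' ≤ (s' : EReal))
    (ha : 0 ≤ a) (hb : 0 ≤ b) (hab : a + b = 1) :
    f (a • y + b • y') ≤ ((a * s + b * s' : ℝ) : EReal) := by
  refine (hf.convex y y' a b ha hb hab).trans ?_
  rw [EReal.coe_add, EReal.coe_mul, EReal.coe_mul]
  exact add_le_add (mul_le_mul_of_nonneg_left hy (EReal.coe_nonneg.2 ha))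
    (mul_le_mul_of_nonneg_left hy' (EReal.coe_nonneg.2 hb))

/-- A minimizing sequence of `y ↦ f y + ‖x - y‖² / (2γ)` is Cauchy by the parallelogram identity,
and its limit is a minimizer because the epigraph of `f` is closed. -/
theorem IsProperConvexLsc.exists_isMinOn_add_sq [CompleteSpace H] {f : H → EReal}
    (hf : IsProperConvexLsc f) {m : ℝ} (hm : ∀ y, (m : EReal) ≤ f y) {γ : ℝ} (hγ : 0 < γ) (x : H) :
    ∃ (p : H) (v : ℝ), f p = (v : EReal) ∧ ∀ (y : H) (s : ℝ), f y ≤ (s : EReal) →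
      v + 1 / (2 * γ) * ‖x - p‖ ^ 2 ≤ s + 1 / (2 * γ) * ‖x - y‖ ^ 2 := by
  set c : ℝ := 1 / (2 * γ) with hc
  have hc0 : 0 < c := by positivity
  let S : Set ℝ := {r | ∃ (y : H) (s : ℝ), f y ≤ (s : EReal) ∧ r = s + c * ‖x - y‖ ^ 2}
  have hbdd : BddBelow S := by
    refine ⟨m, ?_⟩
    rintro r ⟨y, s, hys, rfl⟩
    have : m ≤ s := EReal.coe_le_coe_iff.1 ((hm y).trans hys)
    have := mul_nonneg hc0.le (sq_nonneg ‖x - y‖)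
    linarith
  have hne : S.Nonempty := by
    obtain ⟨y, hy⟩ := hf.exists_ne_top
    exact ⟨_, y, (f y).toReal, (EReal.coe_toReal hy (hf.ne_bot y)).ge, rfl⟩
  have hI : ∀ (y : H) (s : ℝ), f y ≤ (s : EReal) → sInf S ≤ s + c * ‖x - y‖ ^ 2 :=
    fun y s hys => csInf_le hbdd ⟨y, s, hys, rfl⟩
  have hex : ∀ n : ℕ, ∃ (y : H) (s : ℝ), f y ≤ (s : EReal) ∧
      s + c * ‖x - y‖ ^ 2 < sInf S + 1 / ((n : ℝ) + 1) := by
    intro n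
    obtain ⟨r, ⟨y, s, hys, rfl⟩, hr⟩ := exists_lt_of_csInf_lt hne
      (show sInf S < sInf S + 1 / ((n : ℝ) + 1) by
        have : (0 : ℝ) < 1 / ((n : ℝ) + 1) := by positivity
        linarith)
    exact ⟨y, s, hys, hr⟩
  choose y s hys hlt using hex
  have hpar : ∀ u w : H, ‖x - ((1 / 2 : ℝ) • u + (1 / 2 : ℝ) • w)‖ ^ 2
      = 1 / 2 * ‖x - u‖ ^ 2 + 1 / 2 * ‖x - w‖ ^ 2 - 1 / 4 * ‖u - w‖ ^ 2 := by
    intro u w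
    simp only [← real_inner_self_eq_norm_sq, inner_add_left, inner_sub_left, inner_add_right,
      inner_sub_right, inner_smul_left, inner_smul_right, real_inner_comm x u, real_inner_comm x w,
      real_inner_comm u w, conj_trivial]
    ring
  have hcauchy : CauchySeq y := by
    refine cauchySeq_of_le_tendsto_0 (fun N : ℕ => √(4 / c * (1 / ((N : ℝ) + 1)))) ?_ ?_
    · intro n k N hn hk
      rw [dist_eq_norm]
      apply Real.le_sqrt_of_sq_le
      have h1 := hI _ _ (hf.le_coe_of_le_coe (hys n) (hys k) (by norm_num : (0 : ℝ) ≤ 1 / 2)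
        (by norm_num : (0 : ℝ) ≤ 1 / 2) (by norm_num))
      rw [hpar] at h1
      have h2 := hlt n
      have h3 := hlt k
      have h4 : 1 / ((n : ℝ) + 1) ≤ 1 / ((N : ℝ) + 1) :=
        one_div_le_one_div_of_le (by positivity) (by exact_mod_cast Nat.succ_le_succ hn)
      have h5 : 1 / ((k : ℝ) + 1) ≤ 1 / ((N : ℝ) + 1) :=
        one_div_le_one_div_of_le (by positivity) (by exact_mod_cast Nat.succ_le_succ hk)
      have h6 : c * ‖y n - y k‖ ^ 2 ≤ 4 * (1 / ((N : ℝ) + 1)) := by nlinarith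
      calc ‖y n - y k‖ ^ 2 = (c * ‖y n - y k‖ ^ 2) / c := by field_simp
        _ ≤ (4 * (1 / ((N : ℝ) + 1))) / c := by gcongr
        _ = _ := by ring
    · have : Tendsto (fun N : ℕ => √(4 / c * (1 / ((N : ℝ) + 1)))) atTop (𝓝 (√(4 / c * 0))) :=
        (tendsto_one_div_add_atTop_nhds_zero_nat.const_mul _).sqrt
      simpa using this
  obtain ⟨p, hp⟩ := cauchySeq_tendsto_of_complete hcauchy
  have hJ : Tendsto (fun n => s n + c * ‖x - y n‖ ^ 2) atTop (𝓝 (sInf S)) := by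
    refine tendsto_of_tendsto_of_tendsto_of_le_of_le tendsto_const_nhds
      (h := fun n : ℕ => sInf S + 1 / ((n : ℝ) + 1)) ?_ (fun n => hI _ _ (hys n))
      (fun n => (hlt n).le)
    simpa using tendsto_one_div_add_atTop_nhds_zero_nat.const_add (sInf S)
  have hs : Tendsto s atTop (𝓝 (sInf S - c * ‖x - p‖ ^ 2)) := by
    have := hJ.sub (((tendsto_const_nhds (x := x)).sub hp).norm.pow 2 |>.const_mul c)
    simpa using this
  have hmem : f p ≤ ((sInf S - c * ‖x - p‖ ^ 2 : ℝ) : EReal) :=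
    hf.isClosed_realEpigraph.mem_of_tendsto (hp.prodMk_nhds hs) (Eventually.of_forall hys)
  have hpt : f p ≠ ⊤ := fun h => by
    rw [h, top_le_iff] at hmem
    exact EReal.coe_ne_top _ hmem
  refine ⟨p, (f p).toReal, (EReal.coe_toReal hpt (hf.ne_bot p)).symm, fun y' s' h' => ?_⟩
  have h1 : (f p).toReal ≤ sInf S - c * ‖x - p‖ ^ 2 := by
    rw [← EReal.coe_toReal hpt (hf.ne_bot p)] at hmem
    exact EReal.coe_le_coe_iff.1 hmem
  linarith [hI y' s' h']

/-- `g` is a subgradient of `f` at `p = x - γ g` and `v = f p`; this says that `p` is the proximal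
point of `x` with parameter `γ`. The subgradient inequality is required at the points of the real
epigraph only, which avoids arithmetic with `+∞`. -/
structure IsProxSubgradient (f : H → EReal) (γ : ℝ) (x g : H) (v : ℝ) : Prop where
  apply_eq : f (x - γ • g) = (v : EReal)
  le_of_le : ∀ (y : H) (s : ℝ), f y ≤ (s : EReal) → v + inner ℝ g (y - (x - γ • g)) ≤ s

/-- Every point has a proximal point: the first-order condition at the minimizer of
`y ↦ f y + ‖x - y‖² / (2γ)`. -/
theorem IsProperConvexLsc.exists_isProxSubgradient [CompleteSpace H] {f : H → EReal}
    (hf : IsProperConvexLsc f) {m : ℝ} (hm : ∀ y, (m : EReal) ≤ f y) {γ : ℝ} (hγ : 0 < γ) (x : H) :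
    ∃ (g : H) (v : ℝ), IsProxSubgradient f γ x g v := by
  obtain ⟨p, v, hpv, hmin⟩ := hf.exists_isMinOn_add_sq hm hγ x
  have hp : x - γ • ((1 / γ) • (x - p)) = p := by
    rw [smul_smul, mul_one_div_cancel hγ.ne', one_smul, sub_sub_cancel]
  refine ⟨(1 / γ) • (x - p), v, by rw [hp, hpv], fun y s hys => ?_⟩
  rw [hp]
  -- compare `p` with `p + θ (y - p)` and let `θ → 0`
  have key : ∀ θ : ℝ, 0 < θ → θ ≤ 1 →
      v + inner ℝ ((1 / γ) • (x - p)) (y - p) - s ≤ θ * (1 / (2 * γ) * ‖y - p‖ ^ 2) := by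
    intro θ h0 h1
    have h2 := hmin _ _ (hf.le_coe_of_le_coe hpv.le hys (sub_nonneg.2 h1) h0.le (by ring))
    have h3 : ‖x - ((1 - θ) • p + θ • y)‖ ^ 2
        = ‖x - p‖ ^ 2 - 2 * θ * inner ℝ (x - p) (y - p) + θ ^ 2 * ‖y - p‖ ^ 2 := by
      have : x - ((1 - θ) • p + θ • y) = (x - p) - θ • (y - p) := by module
      rw [this, norm_sub_sq_real, inner_smul_right, norm_smul, mul_pow, Real.norm_eq_abs, sq_abs]
      ring
    rw [h3] at h2
    rw [inner_smul_left, conj_trivial]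
    have h4 : θ * (v + 1 / γ * inner ℝ (x - p) (y - p) - s)
        ≤ θ * (θ * (1 / (2 * γ) * ‖y - p‖ ^ 2)) := by
      have e : 1 / γ = 2 * (1 / (2 * γ)) := by field_simp
      rw [e]
      nlinarith
    exact le_of_mul_le_mul_left h4 h0
  have hlim : Tendsto (fun θ : ℝ => θ * (1 / (2 * γ) * ‖y - p‖ ^ 2)) (𝓝[>] 0) (𝓝 0) := by
    have : Tendsto (fun θ : ℝ => θ * (1 / (2 * γ) * ‖y - p‖ ^ 2)) (𝓝 0)
        (𝓝 (0 * (1 / (2 * γ) * ‖y - p‖ ^ 2))) := tendsto_id.mul_const _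
    rw [zero_mul] at this
    exact this.mono_left nhdsWithin_le_nhds
  have := ge_of_tendsto hlim (b := v + inner ℝ ((1 / γ) • (x - p)) (y - p) - s) <| by
    filter_upwards [Ioc_mem_nhdsGT (zero_lt_one (α := ℝ))] with θ hθ using key θ hθ.1 hθ.2
  linarith

/-- Completing the square in `r`. -/
theorem inner_add_norm_sq_div {γ : ℝ} (hγ : 0 < γ) (g r : H) :
    -inner ℝ g r + 1 / (2 * γ) * ‖r‖ ^ 2
      = -(γ / 2 * ‖g‖ ^ 2) + γ / 2 * ‖γ⁻¹ • r - g‖ ^ 2 := by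
  rw [norm_sub_sq_real, inner_smul_left, conj_trivial, norm_smul, mul_pow, Real.norm_eq_abs, sq_abs,
    real_inner_comm g r]
  field_simp
  ring

theorem IsProxSubgradient.moreauEnvelope_eq {f : H → EReal} {γ : ℝ} {x g : H} {v : ℝ}
    (h : IsProxSubgradient f γ x g v) (hγ : 0 < γ) (hbot : ∀ y, f y ≠ ⊥) :
    moreauEnvelope f γ x = v + γ / 2 * ‖g‖ ^ 2 := by
  obtain ⟨hv, hg⟩ := h
  have : (⨅ y, f y + ((1 / (2 * γ) * ‖x - y‖ ^ 2 : ℝ) : EReal))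
      = ((v + γ / 2 * ‖g‖ ^ 2 : ℝ) : EReal) := by
    refine le_antisymm ?_ (le_iInf fun y => ?_)
    · refine (iInf_le _ (x - γ • g)).trans ?_
      rw [hv, ← EReal.coe_add, EReal.coe_le_coe_iff, sub_sub_cancel, norm_smul, mul_pow,
        Real.norm_eq_abs, sq_abs]
      apply le_of_eq
      field_simp
    · rcases eq_or_ne (f y) ⊤ with h | h
      · rw [h, EReal.top_add_coe]
        exact le_top
      · rw [← EReal.coe_toReal h (hbot y), ← EReal.coe_add, EReal.coe_le_coe_iff]
        have h1 := hg y (f y).toReal (EReal.coe_toReal h (hbot y)).ge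
        have h2 := inner_add_norm_sq_div hγ g (x - y)
        have h3 : inner ℝ g (y - (x - γ • g)) = γ * ‖g‖ ^ 2 - inner ℝ g (x - y) := by
          rw [← real_inner_self_eq_norm_sq, ← inner_smul_right, ← inner_sub_right]
          congr 1
          abel
        have h4 : 0 ≤ γ / 2 * ‖γ⁻¹ • (x - y) - g‖ ^ 2 := by positivity
        linarith
  rw [moreauEnvelope, this, EReal.toReal_coe]

/-- A function squeezed between two functions with the same derivative and the same value at a
point has that derivative there. -/
theorem HasFDerivAt.of_squeeze {E : Type*} [NormedAddCommGroup E] [NormedSpace ℝ E]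
    {l φ u : E → ℝ} {d : E →L[ℝ] ℝ} {x : E} (hl : HasFDerivAt l d x) (hu : HasFDerivAt u d x)
    (hlφ : ∀ᶠ y in 𝓝 x, l y ≤ φ y) (hφu : ∀ᶠ y in 𝓝 x, φ y ≤ u y)
    (hlx : l x = φ x) (hux : u x = φ x) : HasFDerivAt φ d x := by
  have h0 : HasFDerivAt (fun y => φ y - l y) (0 : E →L[ℝ] ℝ) x := by
    have h1 := (hu.sub hl).isLittleO
    rw [hasFDerivAt_iff_isLittleO]
    refine IsBigO.trans_isLittleO (IsBigO.of_bound 1 ?_) h1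
    filter_upwards [hlφ, hφu] with y h2 h3
    simp only [hlx, hux, Pi.sub_apply, sub_self, sub_zero, zero_apply, one_mul, Real.norm_eq_abs]
    rw [abs_of_nonneg (by linarith), abs_of_nonneg (by linarith)]
    linarith
  have h4 : (fun y => φ y - l y) + l = φ := funext fun y => sub_add_cancel _ _
  simpa only [h4, zero_add] using h0.add hl

/-- Monotonicity of the subdifferential of `f`, between two proximal points. -/
theorem IsProxSubgradient.inner_sub_nonneg {f : H → EReal} {γ γ' : ℝ} {x x' g g' : H} {v v' : ℝ}
    (h : IsProxSubgradient f γ x g v) (h' : IsProxSubgradient f γ' x' g' v') :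
    0 ≤ inner ℝ (g' - g) ((x' - γ' • g') - (x - γ • g)) := by
  have h1 := h.le_of_le _ _ h'.apply_eq.le
  have h2 := h'.le_of_le _ _ h.apply_eq.le
  rw [← neg_sub, inner_neg_right] at h2
  rw [inner_sub_left]
  linarith

/-- The subgradient inequality at `x - γ g`, evaluated at `x' - γ' g'` and written in terms of the
envelope values `v + γ/2 ‖g‖²`. -/
theorem IsProxSubgradient.lower_bound {f : H → EReal} {γ γ' : ℝ} {x x' g g' : H} {v v' : ℝ}
    (h : IsProxSubgradient f γ x g v) (h' : IsProxSubgradient f γ' x' g' v') :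
    v + γ / 2 * ‖g‖ ^ 2 + inner ℝ g (x' - x) - (γ' - γ) / 2 * ‖g‖ ^ 2 + γ' / 2 * ‖g' - g‖ ^ 2
      ≤ v' + γ' / 2 * ‖g'‖ ^ 2 := by
  have h1 := h.le_of_le _ _ h'.apply_eq.le
  have h2 : x' - γ' • g' - (x - γ • g) = (x' - x) - γ' • g' + γ • g := by abel
  rw [h2, inner_add_right, inner_sub_right, inner_smul_right, inner_smul_right,
    real_inner_self_eq_norm_sq] at h1
  rw [norm_sub_sq_real, real_inner_comm g g']
  linarith

/-- The envelope at `(γ', x')` is at most the value of its defining infimum at `x - γ g`. -/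
theorem IsProxSubgradient.upper_bound {f : H → EReal} {γ γ' : ℝ} {x x' g g' : H} {v v' : ℝ}
    (h : IsProxSubgradient f γ x g v) (h' : IsProxSubgradient f γ' x' g' v') (hγ' : 0 < γ') :
    v' + γ' / 2 * ‖g'‖ ^ 2 ≤ v + 1 / (2 * γ') * ‖x' - x + γ • g‖ ^ 2 := by
  have h1 := h'.le_of_le _ _ h.apply_eq.le
  have h2 : x - γ • g - (x' - γ' • g') = γ' • g' - (x' - x + γ • g) := by abel
  rw [h2, inner_sub_right, inner_smul_right, real_inner_self_eq_norm_sq] at h1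
  have h3 := inner_add_norm_sq_div hγ' g' (x' - x + γ • g)
  have h4 : 0 ≤ γ' / 2 * ‖γ'⁻¹ • (x' - x + γ • g) - g'‖ ^ 2 := by positivity
  linarith

theorem IsProxSubgradient.hasGradientAt [CompleteSpace H] {f : H → EReal}
    (hf : IsProperConvexLsc f) {m : ℝ} (hm : ∀ y, (m : EReal) ≤ f y) {γ : ℝ} (hγ : 0 < γ)
    {x g : H} {v : ℝ} (h : IsProxSubgradient f γ x g v) :
    HasGradientAt (moreauEnvelope f γ) g x := by
  rw [hasGradientAt_iff_hasFDerivAt]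
  have hE := h.moreauEnvelope_eq hγ hf.ne_bot
  have hl : HasFDerivAt (fun y => moreauEnvelope f γ x + inner ℝ g (y - x))
      (InnerProductSpace.toDual ℝ H g) x := by
    have := ((InnerProductSpace.toDual ℝ H g).hasFDerivAt (x := x)).sub_const (inner ℝ g x)
    simpa [inner_sub_right] using this.const_add (moreauEnvelope f γ x)
  have hq : HasFDerivAt (fun y : H => 1 / (2 * γ) * ‖y - x‖ ^ 2) (0 : H →L[ℝ] ℝ) x := by
    have := (((hasFDerivAt_id (𝕜 := ℝ) x).sub_const x).norm_sq).const_mul (1 / (2 * γ))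
    simpa using this
  refine HasFDerivAt.of_squeeze hl (by simpa using hl.add hq)
    (Eventually.of_forall fun y => ?_) (Eventually.of_forall fun y => ?_) (by simp) (by simp)
  · obtain ⟨g', v', h'⟩ := hf.exists_isProxSubgradient hm hγ y
    have h1 := h.lower_bound h'
    rw [hE, h'.moreauEnvelope_eq hγ hf.ne_bot]
    have h2 : 0 ≤ γ / 2 * ‖g' - g‖ ^ 2 := by positivity
    linarith
  · obtain ⟨g', v', h'⟩ := hf.exists_isProxSubgradient hm hγ y
    have h1 := h.upper_bound h' hγ
    rw [h'.moreauEnvelope_eq hγ hf.ne_bot]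
    simp only [Pi.add_apply, hE]
    refine h1.trans (le_of_eq ?_)
    rw [norm_add_sq_real, inner_smul_right, norm_smul, mul_pow, Real.norm_eq_abs, sq_abs,
      real_inner_comm g]
    field_simp
    ring

/-! ### The envelope as a function of the parameter and the point -/

theorem IsProperConvexLsc.isProxSubgradient_gradient [CompleteSpace H] {f : H → EReal}
    (hf : IsProperConvexLsc f) {m : ℝ} (hm : ∀ y, (m : EReal) ≤ f y) {γ : ℝ} (hγ : 0 < γ) (x : H) :
    ∃ v : ℝ, IsProxSubgradient f γ x (gradient (moreauEnvelope f γ) x) v ∧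
      moreauEnvelope f γ x = v + γ / 2 * ‖gradient (moreauEnvelope f γ) x‖ ^ 2 := by
  obtain ⟨g, v, h⟩ := hf.exists_isProxSubgradient hm hγ x
  rw [(h.hasGradientAt hf hm hγ).gradient]
  exact ⟨v, h, h.moreauEnvelope_eq hγ hf.ne_bot⟩

/-- Convexity of `f_γ(x)` in `x`, concavity in `γ` and co-coercivity of the gradient, in one
inequality between two pairs `(γ, x)` and `(γ', x')`. -/
theorem moreauEnvelope_lower_bound [CompleteSpace H] {f : H → EReal}
    (hf : IsProperConvexLsc f) {m : ℝ} (hm : ∀ y, (m : EReal) ≤ f y) {γ γ' : ℝ} (hγ : 0 < γ)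
    (hγ' : 0 < γ') (x x' : H) :
    moreauEnvelope f γ x + inner ℝ (gradient (moreauEnvelope f γ) x) (x' - x)
      - (γ' - γ) / 2 * ‖gradient (moreauEnvelope f γ) x‖ ^ 2
      + γ' / 2 * ‖gradient (moreauEnvelope f γ') x' - gradient (moreauEnvelope f γ) x‖ ^ 2
      ≤ moreauEnvelope f γ' x' := by
  obtain ⟨v, h, hv⟩ := hf.isProxSubgradient_gradient hm hγ x
  obtain ⟨v', h', hv'⟩ := hf.isProxSubgradient_gradient hm hγ' x'
  have := h.lower_bound h'
  rw [hv, hv']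
  linarith

/-- The right-hand side is smooth in `(γ', x')` and equals `f_γ(x)` at `(γ, x)`. -/
theorem moreauEnvelope_upper_bound [CompleteSpace H] {f : H → EReal}
    (hf : IsProperConvexLsc f) {m : ℝ} (hm : ∀ y, (m : EReal) ≤ f y) {γ γ' : ℝ} (hγ : 0 < γ)
    (hγ' : 0 < γ') (x x' : H) :
    moreauEnvelope f γ' x' ≤ moreauEnvelope f γ x
      - γ / 2 * ‖gradient (moreauEnvelope f γ) x‖ ^ 2
      + 1 / (2 * γ') * ‖x' - x + γ • gradient (moreauEnvelope f γ) x‖ ^ 2 := by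
  obtain ⟨v, h, hv⟩ := hf.isProxSubgradient_gradient hm hγ x
  obtain ⟨v', h', hv'⟩ := hf.isProxSubgradient_gradient hm hγ' x'
  have := h.upper_bound h' hγ'
  rw [hv, hv']
  linarith

/-- Lipschitz dependence of the gradient on the point and on the parameter jointly. -/
theorem norm_gradient_moreauEnvelope_sub_le [CompleteSpace H] {f : H → EReal}
    (hf : IsProperConvexLsc f) {m : ℝ} (hm : ∀ y, (m : EReal) ≤ f y) {γ γ' : ℝ} (hγ : 0 < γ)
    (hγ' : 0 < γ') (x x' : H) :
    γ' * ‖gradient (moreauEnvelope f γ') x' - gradient (moreauEnvelope f γ) x‖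
      ≤ ‖x' - x‖ + |γ' - γ| * ‖gradient (moreauEnvelope f γ) x‖ := by
  have h1 := moreauEnvelope_lower_bound hf hm hγ hγ' x x'
  have h2 := moreauEnvelope_lower_bound hf hm hγ' hγ x' x
  set g := gradient (moreauEnvelope f γ) x
  set g' := gradient (moreauEnvelope f γ') x'
  rcases eq_or_lt_of_le (norm_nonneg (g' - g)) with h0 | h0
  · rw [← h0, mul_zero]
    positivity
  -- adding the two inequalities gives `γ' ‖g' - g‖² ≤ ⟪g' - g, (x' - x) - (γ' - γ) g⟫`
  have h3 : γ' * ‖g' - g‖ ^ 2 ≤ inner ℝ (g' - g) ((x' - x) - (γ' - γ) • g) := by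
    rw [norm_sub_rev g g'] at h2
    have e1 : ‖g'‖ ^ 2 = ‖g' - g‖ ^ 2 + 2 * inner ℝ (g' - g) g + ‖g‖ ^ 2 := by
      rw [← norm_add_sq_real, sub_add_cancel]
    have e2 : inner ℝ g' (x - x') = -inner ℝ g' (x' - x) := by rw [← inner_neg_right, neg_sub]
    rw [e2, e1] at h2
    rw [inner_sub_right, inner_smul_right, inner_sub_left _ _ (x' - x)]
    linarith
  have h4 : inner ℝ (g' - g) ((x' - x) - (γ' - γ) • g)
      ≤ ‖g' - g‖ * (‖x' - x‖ + |γ' - γ| * ‖g‖) := by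
    refine (real_inner_le_norm _ _).trans ?_
    gcongr
    refine (norm_sub_le _ _).trans ?_
    rw [norm_smul, Real.norm_eq_abs]
  refine le_of_mul_le_mul_left ?_ h0
  linarith

section Minimizer

variable {f : H → EReal} {z : H}

theorem coe_minValue_eq (hf : IsProperConvexLsc f) (hz : z ∈ argminSet f) :
    ((minValue f : ℝ) : EReal) = f z := by
  have h1 : (⨅ y, f y) = f z := le_antisymm (iInf_le _ z) (le_iInf hz)
  obtain ⟨y, hy⟩ := hf.exists_ne_top
  rw [minValue, h1, EReal.coe_toReal (ne_top_of_le_ne_top hy (hz y)) (hf.ne_bot z)]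

theorem isProxSubgradient_of_mem_argminSet (hf : IsProperConvexLsc f) (hz : z ∈ argminSet f)
    (γ : ℝ) : IsProxSubgradient f γ z 0 (minValue f) where
  apply_eq := by rw [smul_zero, sub_zero, coe_minValue_eq hf hz]
  le_of_le y s hys := by
    rw [inner_zero_left, add_zero, ← EReal.coe_le_coe_iff, coe_minValue_eq hf hz]
    exact (hz y).trans hys

theorem minValue_le (hf : IsProperConvexLsc f) (hz : z ∈ argminSet f) (y : H) :
    ((minValue f : ℝ) : EReal) ≤ f y :=
  (coe_minValue_eq hf hz).trans_le (hz y)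

theorem moreauEnvelope_of_mem_argminSet (hf : IsProperConvexLsc f)
    (hz : z ∈ argminSet f) {γ : ℝ} (hγ : 0 < γ) : moreauEnvelope f γ z = minValue f := by
  simpa using (isProxSubgradient_of_mem_argminSet hf hz γ).moreauEnvelope_eq hγ hf.ne_bot

variable [CompleteSpace H]

theorem gradient_moreauEnvelope_of_mem_argminSet (hf : IsProperConvexLsc f)
    (hz : z ∈ argminSet f) {γ : ℝ} (hγ : 0 < γ) : gradient (moreauEnvelope f γ) z = 0 :=
  ((isProxSubgradient_of_mem_argminSet hf hz γ).hasGradientAt hf (minValue_le hf hz) hγ).gradient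

theorem mem_argminSet_of_gradient_moreauEnvelope_eq_zero (hf : IsProperConvexLsc f) {m : ℝ}
    (hm : ∀ y, (m : EReal) ≤ f y) {γ : ℝ} (hγ : 0 < γ) {x : H}
    (h : gradient (moreauEnvelope f γ) x = 0) : x ∈ argminSet f := by
  obtain ⟨v, hv, -⟩ := hf.isProxSubgradient_gradient hm hγ x
  rw [h] at hv
  intro y
  rcases eq_or_ne (f y) ⊤ with hy | hy
  · rw [hy]
    exact le_top
  · have h1 := hv.le_of_le y (f y).toReal (EReal.coe_toReal hy (hf.ne_bot y)).ge
    have h2 := hv.apply_eq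
    rw [smul_zero, sub_zero] at h2
    rw [inner_zero_left, add_zero] at h1
    rw [h2, ← EReal.coe_toReal hy (hf.ne_bot y)]
    exact EReal.coe_le_coe_iff.2 h1

/-- The lower bound for the envelope, based at a minimizer, where the gradient vanishes. -/
theorem sq_norm_gradient_le_moreauEnvelope_sub (hf : IsProperConvexLsc f)
    (hz : z ∈ argminSet f) {γ : ℝ} (hγ : 0 < γ) (x : H) :
    γ / 2 * ‖gradient (moreauEnvelope f γ) x‖ ^ 2 ≤ moreauEnvelope f γ x - minValue f := by
  have h := moreauEnvelope_lower_bound hf (minValue_le hf hz) hγ hγ z x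
  simp only [gradient_moreauEnvelope_of_mem_argminSet hf hz hγ,
    moreauEnvelope_of_mem_argminSet hf hz hγ, inner_zero_left, sub_zero, norm_zero, sub_self] at h
  linarith

theorem moreauEnvelope_sub_le_inner (hf : IsProperConvexLsc f)
    (hz : z ∈ argminSet f) {γ : ℝ} (hγ : 0 < γ) (x : H) :
    moreauEnvelope f γ x - minValue f ≤ inner ℝ (gradient (moreauEnvelope f γ) x) (x - z) := by
  have h := moreauEnvelope_lower_bound hf (minValue_le hf hz) hγ hγ x z
  rw [gradient_moreauEnvelope_of_mem_argminSet hf hz hγ,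
    moreauEnvelope_of_mem_argminSet hf hz hγ, ← neg_sub x z, inner_neg_right] at h
  have : 0 ≤ γ / 2 * ‖0 - gradient (moreauEnvelope f γ) x‖ ^ 2 := by positivity
  linarith

/-- The lower and upper bounds for the envelope are smooth along the curve and touch it at `t` with
the same derivative, so the proximal points need not be differentiated. -/
theorem hasDerivAt_moreauEnvelope (hf : IsProperConvexLsc f)
    (hz : z ∈ argminSet f) {γ : ℝ → ℝ} {x : ℝ → H} {γ' t : ℝ} {x' : H}
    (hγ : HasDerivAt γ γ' t) (hx : HasDerivAt x x' t) (hpos : ∀ᶠ s in 𝓝 t, 0 < γ s) :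
    HasDerivAt (fun s => moreauEnvelope f (γ s) (x s))
      (inner ℝ (gradient (moreauEnvelope f (γ t)) (x t)) x'
        - γ' / 2 * ‖gradient (moreauEnvelope f (γ t)) (x t)‖ ^ 2) t := by
  have ht := hpos.self_of_nhds
  set g := gradient (moreauEnvelope f (γ t)) (x t) with hg
  have hm := minValue_le hf hz
  have hl : HasDerivAt (fun s => moreauEnvelope f (γ t) (x t) + inner ℝ g (x s - x t)
      - (γ s - γ t) / 2 * ‖g‖ ^ 2) (inner ℝ g x' - γ' / 2 * ‖g‖ ^ 2) t := by
    have h1 := (hasDerivAt_const t g).inner ℝ (hx.sub_const (x t))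
    have h2 := ((hγ.sub_const (γ t)).div_const 2).mul_const (‖g‖ ^ 2)
    refine ((h1.const_add (moreauEnvelope f (γ t) (x t))).sub h2).congr_deriv ?_
    simp
  have hu : HasDerivAt (fun s => moreauEnvelope f (γ t) (x t) - γ t / 2 * ‖g‖ ^ 2
      + 1 / (2 * γ s) * ‖x s - x t + γ t • g‖ ^ 2) (inner ℝ g x' - γ' / 2 * ‖g‖ ^ 2) t := by
    have h1 := ((hx.sub_const (x t)).add_const (γ t • g)).norm_sq
    have h2 := (hγ.const_mul 2).fun_inv (by positivity)
    refine ((h2.mul h1).const_add (moreauEnvelope f (γ t) (x t) - γ t / 2 * ‖g‖ ^ 2)).congr_deriv ?_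
      |>.congr_of_eventuallyEq (Eventually.of_forall fun s => by simp)
    simp only [sub_self, zero_add, norm_smul, inner_smul_left, conj_trivial, mul_pow,
      Real.norm_eq_abs, sq_abs]
    field_simp
    ring
  rw [hasDerivAt_iff_hasFDerivAt] at hl hu ⊢
  refine HasFDerivAt.of_squeeze hl hu ?_ ?_ (by simp) ?_
  · filter_upwards [hpos] with s hs
    have h1 := moreauEnvelope_lower_bound hf hm ht hs (x t) (x s)
    have h2 : 0 ≤ γ s / 2 * ‖gradient (moreauEnvelope f (γ s)) (x s)
      - gradient (moreauEnvelope f (γ t)) (x t)‖ ^ 2 := by positivity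
    linarith
  · filter_upwards [hpos] with s hs
    exact moreauEnvelope_upper_bound hf hm ht hs (x t) (x s)
  · simp only [sub_self, zero_add, norm_smul, mul_pow, Real.norm_eq_abs, sq_abs]
    field_simp
    ring

end Minimizer

end MoreauEnvelope

/-! ### Regularity of solution trajectories -/

section Regularity

theorem continuousOn_Ici_of_forall_Icc {X : Type*} [TopologicalSpace X] {h : ℝ → X} {a : ℝ}
    (hh : ∀ T, a ≤ T → ContinuousOn h (Icc a T)) : ContinuousOn h (Ici a) := by
  intro t ht
  have h1 := hh (t + 1) (le_trans ht (by linarith)) t ⟨ht, by linarith⟩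
  refine h1.mono_of_mem_nhdsWithin ?_
  filter_upwards [self_mem_nhdsWithin, nhdsWithin_le_nhds (Iic_mem_nhds (lt_add_one t))]
    with s hs hs' using ⟨hs, hs'⟩

/-- An absolutely continuous function whose derivative coincides almost everywhere with a
continuous function is continuously differentiable. -/
theorem hasDerivAt_of_ae_hasDerivAt {F : Type*} [NormedAddCommGroup F] [NormedSpace ℝ F]
    [CompleteSpace F] {y k : ℝ → F} {a : ℝ}
    (hy : ∀ T, a ≤ T → AbsolutelyContinuousOnInterval y a T) (hk : ContinuousOn k (Ici a))
    (hae : ∀ᵐ t ∂(volume.restrict (Ici a)), HasDerivAt y (k t) t) {t : ℝ} (ht : a < t) :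
    HasDerivAt y (k t) t := by
  -- extend `k` by a constant to the left of `a`
  let k' : ℝ → F := fun s => k (max a s)
  have hk' : Continuous k' :=
    hk.comp_continuous (continuous_const.max continuous_id) fun s => le_max_left a s
  have hkk : ∀ s, a ≤ s → k' s = k s := fun s hs => by simp only [k', max_eq_right hs]
  have hI : ∀ s, HasDerivAt (fun r => ∫ τ in a..r, k' τ) (k' s) s := fun s =>
    intervalIntegral.integral_hasDerivAt_right (hk'.intervalIntegrable a s)
      (hk'.stronglyMeasurableAtFilter _ _) hk'.continuousAt
  have hIC : ContDiff ℝ 1 (fun r => ∫ τ in a..r, k' τ) := by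
    rw [contDiff_one_iff_deriv]
    refine ⟨fun s => (hI s).differentiableAt, ?_⟩
    rw [show deriv (fun r => ∫ τ in a..r, k' τ) = k' from funext fun s => (hI s).deriv]
    exact hk'
  have hT : a ≤ t + 1 := by linarith
  have hac : AbsolutelyContinuousOnInterval (fun r => y r - ∫ τ in a..r, k' τ) a (t + 1) :=
    (hy _ hT).sub hIC.contDiffOn.absolutelyContinuousOnInterval
  obtain ⟨C, hC⟩ := hac.const_of_ae_hasDerivAt_zero <| by
    rw [ae_restrict_iff' measurableSet_Ici] at hae
    filter_upwards [hae] with s hs hs'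
    rw [uIcc_of_le hT] at hs'
    have := (hs hs'.1).sub (hI s)
    rwa [hkk s hs'.1, sub_self] at this
  rw [uIcc_of_le hT] at hC
  rw [← hkk t ht.le]
  refine ((hI t).add_const C).congr_of_eventuallyEq ?_
  filter_upwards [Ioo_mem_nhds ht (lt_add_one t)] with s hs
  rw [← hC s ⟨hs.1.le, hs.2.le⟩, add_sub_cancel]

variable {H : Type*} [NormedAddCommGroup H] [InnerProductSpace ℝ H] [CompleteSpace H]

/-- The gradient of the Moreau envelope along a `C¹` curve and a `C¹` parameter is Lipschitz on
compact intervals. -/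
theorem absolutelyContinuousOnInterval_gradient_moreauEnvelope {f : H → EReal} {z : H}
    (hf : IsProperConvexLsc f) (hz : z ∈ argminSet f) {γ : ℝ → ℝ} {x : ℝ → H} {a b : ℝ}
    (hγ : ContDiffOn ℝ 1 γ (uIcc a b)) (hx : ContDiffOn ℝ 1 x (uIcc a b))
    (hpos : ∀ t ∈ uIcc a b, 0 < γ t) :
    AbsolutelyContinuousOnInterval (fun t => gradient (moreauEnvelope f (γ t)) (x t)) a b := by
  have hm := minValue_le hf hz
  obtain ⟨K, hK⟩ := hγ.exists_lipschitzOnWith (by decide) (convex_uIcc _ _) isCompact_uIcc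
  obtain ⟨L, hL⟩ := hx.exists_lipschitzOnWith (by decide) (convex_uIcc _ _) isCompact_uIcc
  obtain ⟨t₁, ht₁, hmin⟩ := isCompact_uIcc.exists_isMinOn nonempty_uIcc hγ.continuousOn
  obtain ⟨M, hM⟩ := isCompact_uIcc.exists_bound_of_continuousOn
    (hx.continuousOn.sub (continuousOn_const (c := z)))
  have hc := hpos t₁ ht₁
  set c := γ t₁
  have hM0 : 0 ≤ M := (norm_nonneg _).trans (hM t₁ ht₁)
  have hg : ∀ t ∈ uIcc a b, ‖gradient (moreauEnvelope f (γ t)) (x t)‖ ≤ M / c := by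
    intro t ht
    have h1 := norm_gradient_moreauEnvelope_sub_le hf hm (hpos t ht) (hpos t ht) z (x t)
    rw [gradient_moreauEnvelope_of_mem_argminSet hf hz (hpos t ht), sub_zero, norm_zero, mul_zero,
      add_zero] at h1
    rw [le_div_iff₀ hc, mul_comm]
    exact (mul_le_mul_of_nonneg_right (hmin ht) (norm_nonneg _)).trans (h1.trans (hM t ht))
  refine (LipschitzOnWith.of_dist_le_mul (K := Real.toNNReal ((L + K * (M / c)) / c))
    fun s hs t ht => ?_).absolutelyContinuousOnInterval
  have hA : 0 ≤ M / c := by positivity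
  rw [Real.coe_toNNReal _ (by positivity), div_mul_eq_mul_div, le_div_iff₀ hc, mul_comm]
  have h1 := norm_gradient_moreauEnvelope_sub_le hf hm (hpos t ht) (hpos s hs) (x t) (x s)
  have h2 := hK.dist_le_mul s hs t ht
  have h3 := hL.dist_le_mul s hs t ht
  rw [Real.dist_eq] at h2
  rw [dist_eq_norm] at h3 ⊢
  calc c * ‖gradient (moreauEnvelope f (γ s)) (x s) - gradient (moreauEnvelope f (γ t)) (x t)‖
      ≤ γ s * ‖gradient (moreauEnvelope f (γ s)) (x s)
          - gradient (moreauEnvelope f (γ t)) (x t)‖ := by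
        gcongr
        exact hmin hs
    _ ≤ L * dist s t + K * dist s t * (M / c) := by
        refine h1.trans (add_le_add h3 ?_)
        exact mul_le_mul h2 (hg t ht) (norm_nonneg _) (by positivity)
    _ = (L + K * (M / c)) * dist s t := by ring

variable {f : H → EReal} {α β t₀ : ℝ} {δ γ : ℝ → ℝ} {x : ℝ → H}

theorem IsSolutionNSHR.continuousOn_velocity (hx : IsSolutionNSHR f α β t₀ δ γ x) :
    ContinuousOn (derivWithin x (Ici t₀)) (Ici t₀) :=
  continuousOn_Ici_of_forall_Icc fun T hT => by
    simpa [uIcc_of_le hT] using (hx.velocity_ac T hT).continuousOn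

theorem IsSolutionNSHR.contDiffOn (hx : IsSolutionNSHR f α β t₀ δ γ x) :
    ContDiffOn ℝ 1 x (Ici t₀) := by
  rw [contDiffOn_one_iff_derivWithin (uniqueDiffOn_Ici t₀)]
  exact ⟨hx.differentiableOn, hx.continuousOn_velocity⟩

theorem IsSolutionNSHR.hasDerivAt (hx : IsSolutionNSHR f α β t₀ δ γ x) {t : ℝ} (ht : t₀ < t) :
    HasDerivAt x (derivWithin x (Ici t₀) t) t :=
  (hx.differentiableOn t ht.le).hasDerivWithinAt.hasDerivAt (Ici_mem_nhds ht)

theorem hasDerivAt_derivWithin_of_contDiffOn {h : ℝ → ℝ} {a : ℝ} (hh : ContDiffOn ℝ 1 h (Ici a))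
    {t : ℝ} (ht : a < t) : HasDerivAt h (derivWithin h (Ici a) t) t :=
  ((hh.differentiableOn one_ne_zero) t ht.le).hasDerivWithinAt.hasDerivAt (Ici_mem_nhds ht)

theorem IsSolutionNSHR.absolutelyContinuousOnInterval_gradient (hf : IsProperConvexLsc f)
    {z : H} (hz : z ∈ argminSet f) (hcoef : CoefficientAssumption α β t₀ δ γ)
    (hx : IsSolutionNSHR f α β t₀ δ γ x) {T : ℝ} (hT : t₀ ≤ T) :
    AbsolutelyContinuousOnInterval
      (fun t => gradient (moreauEnvelope f (γ t)) (x t)) t₀ T := by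
  have hs : uIcc t₀ T ⊆ Ici t₀ := by
    rw [uIcc_of_le hT]
    exact Icc_subset_Ici_self
  exact absolutelyContinuousOnInterval_gradient_moreauEnvelope hf hz
    (hcoef.gamma_contDiff.mono hs) (hx.contDiffOn.mono hs) fun t ht => hcoef.gamma_pos t (hs ht)

theorem IsSolutionNSHR.continuousOn_gradient (hf : IsProperConvexLsc f)
    {z : H} (hz : z ∈ argminSet f) (hcoef : CoefficientAssumption α β t₀ δ γ)
    (hx : IsSolutionNSHR f α β t₀ δ γ x) :
    ContinuousOn (fun t => gradient (moreauEnvelope f (γ t)) (x t)) (Ici t₀) :=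
  continuousOn_Ici_of_forall_Icc fun T hT => by
    simpa [uIcc_of_le hT] using
      (hx.absolutelyContinuousOnInterval_gradient hf hz hcoef hT).continuousOn

/-- The combination `ẋ + β δ ∇f_γ(x)` is continuously differentiable, although each of its two
terms is only absolutely continuous, and the equation gives its derivative at every time. -/
theorem IsSolutionNSHR.hasDerivAt_velocity_add (hf : IsProperConvexLsc f)
    {z : H} (hz : z ∈ argminSet f) (ht₀ : 0 < t₀) (hcoef : CoefficientAssumption α β t₀ δ γ)
    (hx : IsSolutionNSHR f α β t₀ δ γ x) {t : ℝ} (ht : t₀ < t) :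
    HasDerivAt (fun s => derivWithin x (Ici t₀) s + β • rescaledGradient f δ γ x s)
      (-((α / t) • derivWithin x (Ici t₀) t + (1 + β / t) • rescaledGradient f δ γ x t)) t := by
  have hV := hx.continuousOn_velocity
  have hu : ContinuousOn (rescaledGradient f δ γ x) (Ici t₀) :=
    hcoef.delta_contDiff.continuousOn.smul (hx.continuousOn_gradient hf hz hcoef)
  have hdiv : ∀ c : ℝ, ContinuousOn (fun s : ℝ => c / s) (Ici t₀) := fun c =>
    continuousOn_const.div continuousOn_id fun s hs => (ht₀.trans_le hs).ne'
  refine hasDerivAt_of_ae_hasDerivAt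
    (k := fun t => -((α / t) • derivWithin x (Ici t₀) t
      + (1 + β / t) • rescaledGradient f δ γ x t)) (fun T hT => ?_) ?_ ?_ ht
  · have h1 : AbsolutelyContinuousOnInterval δ t₀ T := by
      refine (hcoef.delta_contDiff.mono ?_).absolutelyContinuousOnInterval
      rw [uIcc_of_le hT]
      exact Icc_subset_Ici_self
    exact (hx.velocity_ac T hT).add
      ((h1.smul (hx.absolutelyContinuousOnInterval_gradient hf hz hcoef hT)).const_smul β)
  · exact (((hdiv α).smul hV).add ((continuousOn_const.add (hdiv β)).smul hu)).neg
  · filter_upwards [hx.equation] with s hs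
    obtain ⟨acc, g, hacc, hg, heq⟩ := hs
    refine (hacc.add (hg.const_smul β)).congr_deriv ?_
    rw [eq_neg_iff_add_eq_zero, ← heq]
    abel

end Regularity

/-! ### Lyapunov analysis -/

section Lyapunov

/-- A nonnegative function `E` with `E' ≤ -h ≤ 0` converges, and its decrease dominates the
integral of `h`. -/
theorem exists_tendsto_and_integrableOn_of_deriv_le_neg {E E' h : ℝ → ℝ} {T : ℝ}
    (hE : ∀ t, T ≤ t → HasDerivAt E (E' t) t) (hE0 : ∀ t, T ≤ t → 0 ≤ E t)
    (hle : ∀ t, T ≤ t → E' t ≤ -h t) (hh : ∀ t, T ≤ t → 0 ≤ h t)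
    (hc : ContinuousOn h (Ici T)) :
    (∃ l, Tendsto E atTop (𝓝 l)) ∧ IntegrableOn h (Ioi T) := by
  have hneg : ∀ t, T ≤ t → E' t ≤ 0 := fun t ht => by linarith [hle t ht, hh t ht]
  have hanti : AntitoneOn E (Ici T) := by
    refine antitoneOn_of_deriv_nonpos (convex_Ici T)
      (fun t ht => (hE t ht).continuousAt.continuousWithinAt)
      (fun t ht => ?_) (fun t ht => ?_) <;> rw [interior_Ici] at ht
    · exact (hE t (le_of_lt ht)).differentiableAt.differentiableWithinAt
    · rw [(hE t (le_of_lt ht)).deriv]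
      exact hneg t (le_of_lt ht)
  have hanti' : Antitone fun t => E (max T t) := fun s t hst =>
    hanti (mem_Ici.2 (le_max_left T s)) (mem_Ici.2 (le_max_left T t)) (max_le_max le_rfl hst)
  have hbdd : BddBelow (range fun t => E (max T t)) := by
    refine ⟨0, ?_⟩
    rintro _ ⟨t, rfl⟩
    exact hE0 _ (le_max_left _ _)
  have hlim : Tendsto E atTop (𝓝 (⨅ t, E (max T t))) :=
    (tendsto_atTop_ciInf hanti' hbdd).congr' <| by
      filter_upwards [eventually_ge_atTop T] with t ht
      rw [max_eq_right ht]
  refine ⟨⟨_, hlim⟩, ?_⟩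
  have hint := integrableOn_Ioi_deriv_of_nonpos' (fun t ht => hE t ht)
    (fun t ht => hneg t (le_of_lt ht)) hlim
  refine Integrable.mono' hint.neg
    ((hc.mono Ioi_subset_Ici_self).aestronglyMeasurable measurableSet_Ioi) ?_
  filter_upwards [ae_restrict_mem measurableSet_Ioi] with t ht
  have ht' : T ≤ t := le_of_lt ht
  rw [Real.norm_eq_abs, abs_of_nonneg (hh t ht'), Pi.neg_apply]
  linarith [hle t ht']

/-- Since `1 / t` is not integrable at infinity, a convergent function `S` with `S(t) / t`
integrable tends to `0`. -/
theorem eq_zero_of_tendsto_of_integrableOn_div {S : ℝ → ℝ} {T l : ℝ}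
    (hS : Tendsto S atTop (𝓝 l)) (hint : IntegrableOn (fun t => S t / t) (Ioi T)) : l = 0 := by
  by_contra hl
  have hl0 : 0 < |l| / 2 := by positivity
  obtain ⟨A, hA⟩ := eventually_atTop.1
    ((hS.abs.eventually_const_lt (half_lt_self (abs_pos.2 hl))).and
      ((eventually_gt_atTop T).and (eventually_gt_atTop 0)))
  have hint' : IntegrableOn (fun t => S t / t) (Ioi A) :=
    hint.mono_set (Ioi_subset_Ioi (hA A le_rfl).2.1.le)
  refine not_integrableOn_Ioi_inv (a := A) ?_
  refine Integrable.mono' (hint'.norm.const_mul (|l| / 2)⁻¹) measurable_inv.aestronglyMeasurable ?_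
  filter_upwards [ae_restrict_mem measurableSet_Ioi] with t ht
  obtain ⟨h1, -, h3⟩ := hA t (le_of_lt ht)
  rw [norm_div, Real.norm_eq_abs (S t), norm_inv, ← div_eq_inv_mul, le_div_iff₀ hl0,
    div_eq_mul_inv, mul_comm]
  exact mul_le_mul_of_nonneg_right h1.le (by positivity)

/-- The facts about a trajectory that the Lyapunov analysis uses, from time `T` on: `v` is the
velocity of `x`, `g` the gradient along `x`, `φ` the gap to the minimal value, and `z` a
minimizer. The functions `δ'` and `γ'` stand for the derivatives of `δ` and `γ`. -/
structure IsDampedTrajectory {H : Type*} [NormedAddCommGroup H] [InnerProductSpace ℝ H]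
    (α β ζ c T : ℝ) (δ δ' γ' φ : ℝ → ℝ) (x v g : ℝ → H) (z : H) : Prop where
  beta_pos : 0 < β
  zeta_pos : 0 < ζ
  zeta_le : ζ ≤ α - 3
  c_pos : 0 < c
  start_pos : 0 < T
  delta_pos : ∀ t, T ≤ t → 0 < δ t
  hasDerivAt_delta : ∀ t, T ≤ t → HasDerivAt δ (δ' t) t
  hasDerivAt_x : ∀ t, T ≤ t → HasDerivAt x (v t) t
  hasDerivAt_gap : ∀ t, T ≤ t → HasDerivAt φ (inner ℝ (g t) (v t) - γ' t / 2 * ‖g t‖ ^ 2) t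
  hasDerivAt_velocity_add : ∀ t, T ≤ t → HasDerivAt (fun s => v s + β • δ s • g s)
    (-((α / t) • v t + (1 + β / t) • δ t • g t)) t
  continuousOn_velocity : ContinuousOn v (Ici T)
  continuousOn_gradient : ContinuousOn g (Ici T)
  gap_nonneg : ∀ t, T ≤ t → 0 ≤ φ t
  gap_le_inner : ∀ t, T ≤ t → φ t ≤ inner ℝ (g t) (x t - z)
  delta_growth : ∀ t, T ≤ t → 0 ≤ t * δ' t ∧ t * δ' t ≤ (α - 3 - ζ) * δ t
  le_gamma' : ∀ t, T ≤ t → c * (t * δ t) ≤ γ' t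

/-- The Lyapunov function with parameter `ε`; the factor of `x - z` is `α - 1 - ε`. -/
noncomputable def dampedEnergy {H : Type*} [NormedAddCommGroup H] [InnerProductSpace ℝ H]
    (α β ε : ℝ) (δ φ : ℝ → ℝ) (x v g : ℝ → H) (z : H) (t : ℝ) : ℝ :=
  (t ^ 2 * δ t + β * ε * (t * δ t)) * φ t
    + 1 / 2 * ‖(α - 1 - ε) • (x t - z) + t • (v t + β • δ t • g t)‖ ^ 2
    + (α - 1 - ε) * ε / 2 * ‖x t - z‖ ^ 2

namespace IsDampedTrajectory

variable {H : Type*} [NormedAddCommGroup H] [InnerProductSpace ℝ H]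
  {α β ζ c T : ℝ} {δ δ' γ' φ : ℝ → ℝ} {x v g : ℝ → H} {z : H}

theorem mono (h : IsDampedTrajectory α β ζ c T δ δ' γ' φ x v g z) {T' : ℝ} (hT : T ≤ T') :
    IsDampedTrajectory α β ζ c T' δ δ' γ' φ x v g z where
  beta_pos := h.beta_pos
  zeta_pos := h.zeta_pos
  zeta_le := h.zeta_le
  c_pos := h.c_pos
  start_pos := h.start_pos.trans_le hT
  delta_pos t ht := h.delta_pos t (hT.trans ht)
  hasDerivAt_delta t ht := h.hasDerivAt_delta t (hT.trans ht)
  hasDerivAt_x t ht := h.hasDerivAt_x t (hT.trans ht)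
  hasDerivAt_gap t ht := h.hasDerivAt_gap t (hT.trans ht)
  hasDerivAt_velocity_add t ht := h.hasDerivAt_velocity_add t (hT.trans ht)
  continuousOn_velocity := h.continuousOn_velocity.mono (Ici_subset_Ici.2 hT)
  continuousOn_gradient := h.continuousOn_gradient.mono (Ici_subset_Ici.2 hT)
  gap_nonneg t ht := h.gap_nonneg t (hT.trans ht)
  gap_le_inner t ht := h.gap_le_inner t (hT.trans ht)
  delta_growth t ht := h.delta_growth t (hT.trans ht)
  le_gamma' t ht := h.le_gamma' t (hT.trans ht)

theorem hasDerivAt_dampedEnergy (h : IsDampedTrajectory α β ζ c T δ δ' γ' φ x v g z) (ε : ℝ)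
    {t : ℝ} (ht : T ≤ t) :
    HasDerivAt (dampedEnergy α β ε δ φ x v g z)
      ((2 * t * δ t + t ^ 2 * δ' t + β * ε * (δ t + t * δ' t)) * φ t
        - (α - 1 - ε) * (t * δ t) * inner ℝ (g t) (x t - z)
        - ε * (t * ‖v t‖ ^ 2) - β * (t ^ 2 * δ t ^ 2 * ‖g t‖ ^ 2)
        - (t ^ 2 * δ t + β * ε * (t * δ t)) * (γ' t / 2 * ‖g t‖ ^ 2)) t := by
  have ht0 : t ≠ 0 := (h.start_pos.trans_le ht).ne'
  have hid := hasDerivAt_id' t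
  have h1 := ((((hid.fun_pow 2).mul (h.hasDerivAt_delta t ht)).add
    ((hid.mul (h.hasDerivAt_delta t ht)).const_mul (β * ε))).mul (h.hasDerivAt_gap t ht))
  have hxz := (h.hasDerivAt_x t ht).sub_const z
  have h2 := ((hxz.const_smul (α - 1 - ε)).add
    (hid.smul (h.hasDerivAt_velocity_add t ht))).norm_sq.const_mul (1 / 2)
  have h3 := hxz.norm_sq.const_mul ((α - 1 - ε) * ε / 2)
  -- in the derivative of `(α-1-ε)(x - z) + t (v + β δ g)` the terms with `β` cancel
  have hw : (α - 1 - ε) • v t + (t • -((α / t) • v t + (1 + β / t) • δ t • g t)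
      + (1 : ℝ) • (v t + β • δ t • g t)) = -(ε • v t + (t * δ t) • g t) := by
    simp only [smul_neg, smul_add, smul_smul]
    rw [mul_div_cancel₀ α ht0, show t * ((1 + β / t) * δ t) = t * δ t + β * δ t by
      field_simp]
    module
  refine ((h1.add h2).add h3).congr_deriv ?_
  simp only [Pi.add_apply, Pi.mul_apply, Pi.smul_apply, Pi.smul_apply']
  rw [hw]
  simp only [← real_inner_self_eq_norm_sq, inner_add_left, inner_add_right, inner_smul_left,
    inner_smul_right, inner_neg_right, conj_trivial, real_inner_comm (v t) (g t),
    real_inner_comm (v t) (x t - z), real_inner_comm (g t) (x t - z)]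
  push_cast
  ring

/-- Upper bound for the derivative of the Lyapunov function computed in `hasDerivAt_dampedEnergy`. -/
theorem deriv_dampedEnergy_le (h : IsDampedTrajectory α β ζ c T δ δ' γ' φ x v g z) {ε : ℝ}
    (hε : 0 < ε) (hεζ : ε < ζ) {t : ℝ} (ht : T ≤ t)
    (hlarge : 2 * β * ε * (α - 2 - ζ) ≤ (ζ - ε) * t) :
    (2 * t * δ t + t ^ 2 * δ' t + β * ε * (δ t + t * δ' t)) * φ t
        - (α - 1 - ε) * (t * δ t) * inner ℝ (g t) (x t - z)
        - ε * (t * ‖v t‖ ^ 2) - β * (t ^ 2 * δ t ^ 2 * ‖g t‖ ^ 2)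
        - (t ^ 2 * δ t + β * ε * (t * δ t)) * (γ' t / 2 * ‖g t‖ ^ 2)
      ≤ -((ζ - ε) / 2 * (t * δ t * φ t) + ε * (t * ‖v t‖ ^ 2)
        + c / 2 * (t ^ 3 * δ t ^ 2 * ‖g t‖ ^ 2)) := by
  have ht0 : 0 < t := h.start_pos.trans_le ht
  have hδ := h.delta_pos t ht
  have hφ := h.gap_nonneg t ht
  have hβ := h.beta_pos
  have hc := h.c_pos
  obtain ⟨hg0, hg1⟩ := h.delta_growth t ht
  have hα := h.zeta_le
  have h1 : (α - 1 - ε) * (t * δ t) * φ t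
      ≤ (α - 1 - ε) * (t * δ t) * inner ℝ (g t) (x t - z) :=
    mul_le_mul_of_nonneg_left (h.gap_le_inner t ht)
      (mul_nonneg (by linarith) (by positivity))
  have h2 : t ^ 2 * δ' t ≤ (α - 3 - ζ) * (t * δ t) := by
    nlinarith [mul_le_mul_of_nonneg_left hg1 ht0.le]
  have h3 : β * ε * (δ t + t * δ' t) ≤ (ζ - ε) / 2 * (t * δ t) := by
    have e1 : β * ε * (δ t + t * δ' t) ≤ β * ε * ((α - 2 - ζ) * δ t) :=
      mul_le_mul_of_nonneg_left (by linarith) (by positivity)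
    nlinarith [mul_le_mul_of_nonneg_right hlarge hδ.le]
  have h4 : (2 * t * δ t + t ^ 2 * δ' t + β * ε * (δ t + t * δ' t)) * φ t
      ≤ ((α - 1 - ε) * (t * δ t) - (ζ - ε) / 2 * (t * δ t)) * φ t :=
    mul_le_mul_of_nonneg_right (by linarith) hφ
  have h5 : c / 2 * (t ^ 3 * δ t ^ 2 * ‖g t‖ ^ 2)
      ≤ (t ^ 2 * δ t + β * ε * (t * δ t)) * (γ' t / 2 * ‖g t‖ ^ 2) := by
    calc c / 2 * (t ^ 3 * δ t ^ 2 * ‖g t‖ ^ 2)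
        = (t ^ 2 * δ t) * (c * (t * δ t) / 2 * ‖g t‖ ^ 2) := by ring
      _ ≤ (t ^ 2 * δ t + β * ε * (t * δ t)) * (γ' t / 2 * ‖g t‖ ^ 2) := by
          have := h.le_gamma' t ht
          have h0 : 0 ≤ β * ε * (t * δ t) := by positivity
          gcongr
          linarith
  have h6 : 0 ≤ β * (t ^ 2 * δ t ^ 2 * ‖g t‖ ^ 2) := by positivity
  linarith

theorem le_dampedEnergy (h : IsDampedTrajectory α β ζ c T δ δ' γ' φ x v g z) {ε : ℝ}
    (hε : 0 < ε) {t : ℝ} (ht : T ≤ t) :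
    t ^ 2 * δ t * φ t + (α - 1 - ε) * ε / 2 * ‖x t - z‖ ^ 2
      ≤ dampedEnergy α β ε δ φ x v g z t := by
  have ht0 : 0 < t := h.start_pos.trans_le ht
  have hδ := h.delta_pos t ht
  have hφ := h.gap_nonneg t ht
  have hβ := h.beta_pos
  have h1 : 0 ≤ β * ε * (t * δ t) * φ t := by positivity
  have h2 : 0 ≤ 1 / 2 * ‖(α - 1 - ε) • (x t - z) + t • (v t + β • δ t • g t)‖ ^ 2 := by positivity
  rw [dampedEnergy]
  linarith

theorem continuousOn_gap (h : IsDampedTrajectory α β ζ c T δ δ' γ' φ x v g z) :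
    ContinuousOn φ (Ici T) := fun t ht => (h.hasDerivAt_gap t ht).continuousAt.continuousWithinAt

theorem continuousOn_delta (h : IsDampedTrajectory α β ζ c T δ δ' γ' φ x v g z) :
    ContinuousOn δ (Ici T) := fun t ht => (h.hasDerivAt_delta t ht).continuousAt.continuousWithinAt

theorem exists_tendsto_dampedEnergy (h : IsDampedTrajectory α β ζ c T δ δ' γ' φ x v g z) {ε : ℝ}
    (hε : 0 < ε) (hεζ : ε < ζ) :
    ∃ T', T ≤ T' ∧ (∃ l, Tendsto (dampedEnergy α β ε δ φ x v g z) atTop (𝓝 l)) ∧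
      IntegrableOn (fun t => (ζ - ε) / 2 * (t * δ t * φ t) + ε * (t * ‖v t‖ ^ 2)
        + c / 2 * (t ^ 3 * δ t ^ 2 * ‖g t‖ ^ 2)) (Ioi T') := by
  have hζε : 0 < ζ - ε := sub_pos.2 hεζ
  set T' := max T (2 * β * ε * (α - 2 - ζ) / (ζ - ε)) with hT'
  have hTT : T ≤ T' := le_max_left _ _
  have hlarge : ∀ t, T' ≤ t → 2 * β * ε * (α - 2 - ζ) ≤ (ζ - ε) * t := fun t ht => by
    rw [← div_le_iff₀' hζε]
    exact (le_max_right _ _).trans ht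
  have h' := h.mono hTT
  refine ⟨T', hTT, exists_tendsto_and_integrableOn_of_deriv_le_neg
    (fun t ht => h'.hasDerivAt_dampedEnergy ε ht) (fun t ht => ?_)
    (fun t ht => h'.deriv_dampedEnergy_le hε hεζ ht (hlarge t ht)) (fun t ht => ?_) ?_⟩
  · refine le_trans ?_ (h'.le_dampedEnergy hε ht)
    have := h'.gap_nonneg t ht
    have := h'.delta_pos t ht
    have : 0 ≤ α - 1 - ε := by linarith [h.zeta_le]
    positivity
  · have := h'.gap_nonneg t ht
    have := h'.delta_pos t ht
    have := h'.start_pos.trans_le ht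
    have := h.c_pos
    positivity
  · have := h'.continuousOn_gap
    have := h'.continuousOn_delta
    have := h'.continuousOn_velocity
    have := h'.continuousOn_gradient
    fun_prop

theorem integrableOn_dissipation (h : IsDampedTrajectory α β ζ c T δ δ' γ' φ x v g z) :
    ∃ T', T ≤ T' ∧ IntegrableOn (fun t => t * δ t * φ t) (Ioi T') ∧
      IntegrableOn (fun t => t * ‖v t‖ ^ 2) (Ioi T') ∧
      IntegrableOn (fun t => t ^ 3 * δ t ^ 2 * ‖g t‖ ^ 2) (Ioi T') := by
  have hζ := h.zeta_pos
  have hc := h.c_pos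
  obtain ⟨T', hT', -, hint⟩ := h.exists_tendsto_dampedEnergy (half_pos hζ) (half_lt_self hζ)
  have hg1 := (h.mono hT').continuousOn_gap
  have hg2 := (h.mono hT').continuousOn_delta
  have hg3 := (h.mono hT').continuousOn_velocity
  have hg4 := (h.mono hT').continuousOn_gradient
  have hpos : ∀ t ∈ Ioi T', 0 ≤ t * δ t * φ t ∧ 0 ≤ t * ‖v t‖ ^ 2
      ∧ 0 ≤ t ^ 3 * δ t ^ 2 * ‖g t‖ ^ 2 := fun t ht => by
    have := (h.mono hT').gap_nonneg t (le_of_lt ht)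
    have := (h.mono hT').delta_pos t (le_of_lt ht)
    have := (h.mono hT').start_pos.trans ht
    refine ⟨?_, ?_, ?_⟩ <;> positivity
  -- each of the three terms is a constant times at most the whole sum
  have key : ∀ {u : ℝ → ℝ} {C : ℝ}, 0 < C → ContinuousOn u (Ici T') →
      (∀ t ∈ Ioi T', 0 ≤ u t ∧ C * u t ≤ (ζ - ζ / 2) / 2 * (t * δ t * φ t)
        + ζ / 2 * (t * ‖v t‖ ^ 2) + c / 2 * (t ^ 3 * δ t ^ 2 * ‖g t‖ ^ 2)) →
      IntegrableOn u (Ioi T') := by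
    intro u C hC hu hle
    refine Integrable.mono' (hint.const_mul C⁻¹)
      ((hu.mono Ioi_subset_Ici_self).aestronglyMeasurable measurableSet_Ioi) ?_
    filter_upwards [ae_restrict_mem measurableSet_Ioi] with t ht
    rw [Real.norm_eq_abs, abs_of_nonneg (hle t ht).1, ← div_eq_inv_mul, le_div_iff₀' hC]
    exact (hle t ht).2
  refine ⟨T', hT', key (C := (ζ - ζ / 2) / 2) (by linarith) (by fun_prop) fun t ht => ?_,
    key (C := ζ / 2) (by linarith) (by fun_prop) fun t ht => ?_,
    key (C := c / 2) (by linarith) (by fun_prop) fun t ht => ?_⟩ <;>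
  · obtain ⟨h1, h2, h3⟩ := hpos t ht
    have e1 : 0 ≤ (ζ - ζ / 2) / 2 * (t * δ t * φ t) := mul_nonneg (by linarith) h1
    have e2 : 0 ≤ ζ / 2 * (t * ‖v t‖ ^ 2) := mul_nonneg (by linarith) h2
    have e3 : 0 ≤ c / 2 * (t ^ 3 * δ t ^ 2 * ‖g t‖ ^ 2) := mul_nonneg (by linarith) h3
    exact ⟨by assumption, by linarith⟩

/-- The nonnegative terms of a convergent Lyapunov function are bounded. -/
theorem exists_bound_gap_and_norm_sub (h : IsDampedTrajectory α β ζ c T δ δ' γ' φ x v g z) :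
    ∃ M, ∀ᶠ t in atTop, t ^ 2 * δ t * φ t ≤ M ∧ ‖x t - z‖ ≤ M := by
  have hζ := h.zeta_pos
  obtain ⟨T', hT', ⟨l, hl⟩, -⟩ := h.exists_tendsto_dampedEnergy (half_pos hζ) (half_lt_self hζ)
  set C := (α - 1 - ζ / 2) * (ζ / 2) / 2 with hC
  have hC0 : 0 < C := by
    have : 0 < α - 1 - ζ / 2 := by linarith [h.zeta_le]
    positivity
  refine ⟨max (l + 1) √((l + 1) / C), ?_⟩
  filter_upwards [hl.eventually_le_const (lt_add_one l), eventually_ge_atTop T] with t ht htT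
  have h1 := (h.le_dampedEnergy (half_pos hζ) htT).trans ht
  have h2 : 0 ≤ t ^ 2 * δ t * φ t := by
    have := h.gap_nonneg t htT
    have := h.delta_pos t htT
    positivity
  have h3 : 0 ≤ C * ‖x t - z‖ ^ 2 := by positivity
  rw [← hC] at h1
  refine ⟨le_max_of_le_left (by linarith), le_max_of_le_right (Real.le_sqrt_of_sq_le ?_)⟩
  rw [le_div_iff₀' hC0]
  linarith

/-- The Lyapunov function, expanded so that the dependence on `ε` is explicit; the quadratic terms
in `ε` cancel. -/
theorem dampedEnergy_eq (ε : ℝ) (t : ℝ) :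
    dampedEnergy α β ε δ φ x v g z t
      = (t ^ 2 * δ t * φ t + t ^ 2 / 2 * ‖v t + β • δ t • g t‖ ^ 2) + β * ε * (t * δ t * φ t)
        + (α - 1 - ε) * ((α - 1) / 2 * ‖x t - z‖ ^ 2
          + inner ℝ (x t - z) (t • (v t + β • δ t • g t))) := by
  rw [dampedEnergy, norm_add_sq_real, norm_smul, norm_smul, inner_smul_left, conj_trivial, mul_pow,
    mul_pow, Real.norm_eq_abs, Real.norm_eq_abs, sq_abs, sq_abs]
  ring

theorem delta_le (h : IsDampedTrajectory α β ζ c T δ δ' γ' φ x v g z) {t : ℝ} (ht : T ≤ t) :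
    δ T ≤ δ t := by
  refine monotoneOn_of_deriv_nonneg (convex_Ici T) h.continuousOn_delta (fun s hs => ?_)
    (fun s hs => ?_) self_mem_Ici ht ht <;> rw [interior_Ici] at hs
  · exact (h.hasDerivAt_delta s (le_of_lt hs)).differentiableAt.differentiableWithinAt
  · rw [(h.hasDerivAt_delta s (le_of_lt hs)).deriv]
    exact nonneg_of_mul_nonneg_right (h.delta_growth s (le_of_lt hs)).1 (h.start_pos.trans hs)

/-- The Lyapunov functions with two different parameters have limits, and comparing them gives the
limits of `(α-1)/2 ‖x - z‖² + ⟪x - z, t (v + β δ g)⟫` and of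
`t² δ φ + t²/2 ‖v + β δ g‖²`. The second limit is `0` because of the dissipation. -/
theorem exists_tendsto_and_tendsto_zero
    (h : IsDampedTrajectory α β ζ c T δ δ' γ' φ x v g z) :
    (∃ l, Tendsto (fun t => (α - 1) / 2 * ‖x t - z‖ ^ 2
        + inner ℝ (x t - z) (t • (v t + β • δ t • g t))) atTop (𝓝 l)) ∧
      Tendsto (fun t => t ^ 2 * δ t * φ t + t ^ 2 / 2 * ‖v t + β • δ t • g t‖ ^ 2)
        atTop (𝓝 0) := by
  have hζ := h.zeta_pos
  have hβ := h.beta_pos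
  set S : ℝ → ℝ := fun t => t ^ 2 * δ t * φ t + t ^ 2 / 2 * ‖v t + β • δ t • g t‖ ^ 2 with hS
  set k : ℝ → ℝ := fun t => (α - 1) / 2 * ‖x t - z‖ ^ 2
    + inner ℝ (x t - z) (t • (v t + β • δ t • g t)) with hk
  set A : ℝ → ℝ := fun t => t * δ t * φ t with hA
  have hA0 : Tendsto A atTop (𝓝 0) := by
    obtain ⟨M, hM⟩ := h.exists_bound_gap_and_norm_sub
    refine squeeze_zero' (g := fun t => M / t) ?_ ?_ (tendsto_const_nhds.div_atTop tendsto_id)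
    · filter_upwards [eventually_ge_atTop T] with t ht
      have := h.gap_nonneg t ht
      have := h.delta_pos t ht
      have := h.start_pos.trans_le ht
      positivity
    · filter_upwards [hM, eventually_ge_atTop T] with t ht htT
      rw [le_div_iff₀ (h.start_pos.trans_le htT)]
      simp only [hA]
      linarith [ht.1]
  have hE : ∀ ε, dampedEnergy α β ε δ φ x v g z
      = fun t => S t + β * ε * A t + (α - 1 - ε) * k t :=
    fun ε => funext fun t => dampedEnergy_eq ε t
  -- any two distinct parameters in `(0, ζ)` serve
  obtain ⟨-, -, ⟨l₁, hl₁⟩, -⟩ := h.exists_tendsto_dampedEnergy (ε := ζ / 2) (by linarith)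
    (by linarith)
  obtain ⟨-, -, ⟨l₂, hl₂⟩, -⟩ := h.exists_tendsto_dampedEnergy (ε := ζ / 4) (by linarith)
    (by linarith)
  rw [hE] at hl₁ hl₂
  have hklim : Tendsto k atTop (𝓝 ((l₂ - l₁ + β * (ζ / 4) * 0) * (4 / ζ))) := by
    refine (((hl₂.sub hl₁).add (hA0.const_mul (β * (ζ / 4)))).mul_const (4 / ζ)).congr fun t => ?_
    field_simp
    ring
  have hSlim : Tendsto S atTop (𝓝 (l₁ - β * (ζ / 2) * 0
      - (α - 1 - ζ / 2) * ((l₂ - l₁ + β * (ζ / 4) * 0) * (4 / ζ)))) := by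
    refine ((hl₁.sub (hA0.const_mul (β * (ζ / 2)))).sub
      (hklim.const_mul (α - 1 - ζ / 2))).congr fun t => ?_
    ring
  refine ⟨⟨_, hklim⟩, ?_⟩
  obtain ⟨T', hT', hi1, hi2, hi3⟩ := h.integrableOn_dissipation
  have h' := h.mono hT'
  have hT0 := h'.start_pos
  have hint : IntegrableOn (fun t => S t / t) (Ioi T') := by
    refine Integrable.mono' ((hi1.add hi2).add (hi3.const_mul (β ^ 2 / T' ^ 2))) ?_ ?_
    · have hg1 := h'.continuousOn_gap
      have hg2 := h'.continuousOn_delta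
      have hg3 := h'.continuousOn_velocity
      have hg4 := h'.continuousOn_gradient
      have hSc : ContinuousOn S (Ici T') := by
        simp only [hS]
        fun_prop
      refine ContinuousOn.aestronglyMeasurable ?_ measurableSet_Ioi
      exact (hSc.mono Ioi_subset_Ici_self).div continuousOn_id
        fun t ht => (hT0.trans ht).ne'
    · filter_upwards [ae_restrict_mem measurableSet_Ioi] with t ht
      have htT : T' < t := ht
      have ht0 : 0 < t := hT0.trans ht
      have hδ := h'.delta_pos t htT.le
      have hφ := h'.gap_nonneg t htT.le
      have hS0 : 0 ≤ S t / t := by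
        simp only [hS]
        positivity
      rw [Real.norm_eq_abs, abs_of_nonneg hS0]
      simp only [Pi.add_apply]
      have e1 : ‖v t + β • δ t • g t‖ ^ 2
          ≤ 2 * ‖v t‖ ^ 2 + 2 * (β ^ 2 * (δ t ^ 2 * ‖g t‖ ^ 2)) := by
        have e2 : ‖v t + β • δ t • g t‖ ≤ ‖v t‖ + β * (δ t * ‖g t‖) := by
          refine (norm_add_le _ _).trans_eq ?_
          rw [norm_smul, norm_smul, Real.norm_of_nonneg hβ.le, Real.norm_of_nonneg hδ.le]
        calc ‖v t + β • δ t • g t‖ ^ 2 ≤ (‖v t‖ + β * (δ t * ‖g t‖)) ^ 2 := by gcongr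
          _ ≤ 2 * ‖v t‖ ^ 2 + 2 * (β ^ 2 * (δ t ^ 2 * ‖g t‖ ^ 2)) := by
            nlinarith [sq_nonneg (‖v t‖ - β * (δ t * ‖g t‖))]
      have e3 : S t / t = t * δ t * φ t + t / 2 * ‖v t + β • δ t • g t‖ ^ 2 := by
        simp only [hS]
        field_simp
      have e4 : t * (β ^ 2 * (δ t ^ 2 * ‖g t‖ ^ 2))
          ≤ β ^ 2 / T' ^ 2 * (t ^ 3 * δ t ^ 2 * ‖g t‖ ^ 2) := by
        have : 1 ≤ t ^ 2 / T' ^ 2 := by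
          rw [one_le_div (by positivity)]
          gcongr
        calc t * (β ^ 2 * (δ t ^ 2 * ‖g t‖ ^ 2))
            = 1 * (t * (β ^ 2 * (δ t ^ 2 * ‖g t‖ ^ 2))) := (one_mul _).symm
          _ ≤ t ^ 2 / T' ^ 2 * (t * (β ^ 2 * (δ t ^ 2 * ‖g t‖ ^ 2))) := by gcongr
          _ = _ := by ring
      have e5 := mul_le_mul_of_nonneg_left e1 (half_pos ht0).le
      rw [e3]
      linarith
  rwa [eq_zero_of_tendsto_of_integrableOn_div hSlim hint] at hSlim

theorem tendsto_gap (h : IsDampedTrajectory α β ζ c T δ δ' γ' φ x v g z) :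
    Tendsto (fun t => t ^ 2 * δ t * φ t) atTop (𝓝 0) := by
  refine squeeze_zero' ?_ ?_ h.exists_tendsto_and_tendsto_zero.2
  · filter_upwards [eventually_ge_atTop T] with t ht
    have := h.gap_nonneg t ht
    have := h.delta_pos t ht
    positivity
  · exact Eventually.of_forall fun t => le_add_of_nonneg_right (by positivity)

theorem tendsto_velocity_add (h : IsDampedTrajectory α β ζ c T δ δ' γ' φ x v g z) :
    Tendsto (fun t => t * ‖v t + β • δ t • g t‖) atTop (𝓝 0) := by
  have h1 : Tendsto (fun t => √(2 * (t ^ 2 * δ t * φ t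
      + t ^ 2 / 2 * ‖v t + β • δ t • g t‖ ^ 2))) atTop (𝓝 0) := by
    simpa using (h.exists_tendsto_and_tendsto_zero.2.const_mul 2).sqrt
  refine squeeze_zero' ?_ ?_ h1
  · filter_upwards [eventually_ge_atTop 0] with t ht
    positivity
  · filter_upwards [eventually_ge_atTop T] with t ht
    have := h.gap_nonneg t ht
    have := h.delta_pos t ht
    apply Real.le_sqrt_of_sq_le
    have : 0 ≤ t ^ 2 * δ t * φ t := by positivity
    rw [mul_pow]
    linarith

theorem exists_tendsto_norm_sub (h : IsDampedTrajectory α β ζ c T δ δ' γ' φ x v g z) :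
    ∃ l, Tendsto (fun t => ‖x t - z‖) atTop (𝓝 l) := by
  obtain ⟨⟨l, hl⟩, -⟩ := h.exists_tendsto_and_tendsto_zero
  obtain ⟨M, hM⟩ := h.exists_bound_gap_and_norm_sub
  have hα : 0 < (α - 1) / 2 := by linarith [h.zeta_le, h.zeta_pos]
  have h0 : Tendsto (fun t => inner ℝ (x t - z) (t • (v t + β • δ t • g t))) atTop (𝓝 0) := by
    refine squeeze_zero_norm' (a := fun t => M * (t * ‖v t + β • δ t • g t‖)) ?_ ?_
    · filter_upwards [hM, eventually_ge_atTop 0] with t ht ht0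
      refine (norm_inner_le_norm _ _).trans ?_
      rw [norm_smul, Real.norm_of_nonneg ht0]
      exact mul_le_mul_of_nonneg_right ht.2 (by positivity)
    · simpa using h.tendsto_velocity_add.const_mul M
  have h1 := ((hl.sub h0).div_const ((α - 1) / 2)).sqrt
  refine ⟨_, h1.congr fun t => ?_⟩
  rw [add_sub_cancel_right, mul_div_cancel_left₀ _ hα.ne', Real.sqrt_sq (norm_nonneg _)]

end IsDampedTrajectory

end Lyapunov

/-! ### Weak convergence -/

section WeakConvergence

variable {H : Type*} [NormedAddCommGroup H] [InnerProductSpace ℝ H]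

theorem tendsto_toWeakSpace_iff_forall_inner [CompleteSpace H] {ι : Type*} {l : Filter ι}
    {x : ι → H} {w : H} :
    Tendsto (fun t => toWeakSpace ℝ H (x t)) l (𝓝 (toWeakSpace ℝ H w)) ↔
      ∀ h : H, Tendsto (fun t => inner ℝ h (x t)) l (𝓝 (inner ℝ h w)) := by
  have hind : IsInducing fun (y : WeakSpace ℝ H) (φ : StrongDual ℝ H) =>
    (topDualPairing ℝ H).flip y φ := ⟨rfl⟩
  rw [hind.tendsto_nhds_iff, tendsto_pi_nhds]
  exact ⟨fun hx h => hx (InnerProductSpace.toDual ℝ H h), fun hx φ => by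
    have := hx ((InnerProductSpace.toDual ℝ H).symm φ)
    simp only [InnerProductSpace.toDual_symm_apply] at this
    exact this⟩

/-- Banach-Alaoglu in a Hilbert space: a bounded family converges weakly along any ultrafilter. -/
theorem exists_tendsto_inner_of_ultrafilter [CompleteSpace H] {ι : Type*} {U : Ultrafilter ι}
    {x : ι → H} {M : ℝ} (hM : ∀ᶠ t in (U : Filter ι), ‖x t‖ ≤ M) :
    ∃ w : H, ∀ h : H, Tendsto (fun t => inner ℝ h (x t)) U (𝓝 (inner ℝ h w)) := by
  let ξ : ι → WeakDual ℝ H := fun t => StrongDual.toWeakDual (InnerProductSpace.toDual ℝ H (x t))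
  have hmem : ∀ᶠ t in (U : Filter ι),
      ξ t ∈ WeakDual.toStrongDual ⁻¹' Metric.closedBall (0 : StrongDual ℝ H) M := by
    filter_upwards [hM] with t ht
    rw [mem_preimage, mem_closedBall_zero_iff]
    exact ((InnerProductSpace.toDual ℝ H).norm_map (x t)).trans_le ht
  obtain ⟨ψ, -, hψ⟩ := (WeakDual.isCompact_closedBall (𝕜 := ℝ) (E := H) 0 M).ultrafilter_le_nhds'
    (U.map ξ) hmem
  refine ⟨(InnerProductSpace.toDual ℝ H).symm (WeakDual.toStrongDual ψ), fun h => ?_⟩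
  have h1 : Tendsto (fun t => ξ t h) U (𝓝 (ψ h)) :=
    ((WeakDual.eval_continuous h).tendsto ψ).comp hψ
  rw [real_inner_comm, InnerProductSpace.toDual_symm_apply]
  refine h1.congr fun t => ?_
  exact real_inner_comm _ _

/-- Opial's lemma. -/
theorem exists_tendsto_toWeakSpace_of_tendsto_norm_sub [CompleteSpace H] {ι : Type*}
    {l : Filter ι} [l.NeBot] {x : ι → H} {Z : Set H} (hZ : Z.Nonempty)
    (hlim : ∀ z ∈ Z, ∃ r, Tendsto (fun t => ‖x t - z‖) l (𝓝 r))
    (hcluster : ∀ (U : Ultrafilter ι) (w : H), (U : Filter ι) ≤ l →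
      (∀ h : H, Tendsto (fun t => inner ℝ h (x t)) U (𝓝 (inner ℝ h w))) → w ∈ Z) :
    ∃ w ∈ Z, Tendsto (fun t => toWeakSpace ℝ H (x t)) l (𝓝 (toWeakSpace ℝ H w)) := by
  obtain ⟨z, hz⟩ := hZ
  obtain ⟨r, hr⟩ := hlim z hz
  have hbdd : ∀ᶠ t in l, ‖x t‖ ≤ r + 1 + ‖z‖ := by
    filter_upwards [hr.eventually_le_const (lt_add_one r)] with t ht
    have := norm_le_norm_sub_add (x t) z
    linarith
  have hex : ∀ U : Ultrafilter ι, (U : Filter ι) ≤ l → ∃ w ∈ Z,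
      ∀ h : H, Tendsto (fun t => inner ℝ h (x t)) U (𝓝 (inner ℝ h w)) := fun U hU => by
    obtain ⟨w, hw⟩ := exists_tendsto_inner_of_ultrafilter (hU hbdd)
    exact ⟨w, hcluster U w hU hw, hw⟩
  obtain ⟨w, hwZ, hw⟩ := hex (Ultrafilter.of l) (Ultrafilter.of_le l)
  refine ⟨w, hwZ, (tendsto_iff_ultrafilter _ _ _).2 fun U hU => ?_⟩
  obtain ⟨w', hwZ', hw'⟩ := hex U hU
  suffices w = w' by
    rw [tendsto_toWeakSpace_iff_forall_inner, this]
    exact hw'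
  obtain ⟨a, ha⟩ := hlim w hwZ
  obtain ⟨b, hb⟩ := hlim w' hwZ'
  -- `⟪w - w', x⟫` has a limit along `l`, which is both `⟪w - w', w⟫` and `⟪w - w', w'⟫`
  have hc : Tendsto (fun t => inner ℝ (w - w') (x t)) l
      (𝓝 ((‖w‖ ^ 2 - ‖w'‖ ^ 2 - (a ^ 2 - b ^ 2)) / 2)) := by
    refine ((((ha.pow 2).sub (hb.pow 2)).const_sub (‖w‖ ^ 2 - ‖w'‖ ^ 2)).div_const 2).congr
      fun t => ?_
    rw [norm_sub_sq_real, norm_sub_sq_real, inner_sub_left, real_inner_comm (x t) w,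
      real_inner_comm (x t) w']
    ring
  have h1 := tendsto_nhds_unique (hc.mono_left (Ultrafilter.of_le l)) (hw (w - w'))
  have h2 := tendsto_nhds_unique (hc.mono_left hU) (hw' (w - w'))
  rw [← sub_eq_zero, ← inner_self_eq_zero (𝕜 := ℝ), inner_sub_right, ← h1, ← h2, sub_self]

/-- The weak limit of `x` minimizes `f` when the gradients of the envelope at `x` and the
displacements to the proximal points both tend to `0`: pass to the limit in the monotonicity
inequality between the proximal point of `x` and the proximal point of `w` with parameter `1`. -/
theorem mem_argminSet_of_tendsto_inner [CompleteSpace H] {f : H → EReal}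
    (hf : IsProperConvexLsc f) {m : ℝ} (hm : ∀ y, (m : EReal) ≤ f y) {ι : Type*} {l : Filter ι}
    [l.NeBot] {x : ι → H} {γ : ι → ℝ} {w : H} {M : ℝ} (hγ : ∀ᶠ t in l, 0 < γ t)
    (hw : ∀ h : H, Tendsto (fun t => inner ℝ h (x t)) l (𝓝 (inner ℝ h w)))
    (hM : ∀ᶠ t in l, ‖x t‖ ≤ M)
    (hg : Tendsto (fun t => ‖gradient (moreauEnvelope f (γ t)) (x t)‖) l (𝓝 0))
    (hγg : Tendsto (fun t => γ t * ‖gradient (moreauEnvelope f (γ t)) (x t)‖) l (𝓝 0)) :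
    w ∈ argminSet f := by
  refine mem_argminSet_of_gradient_moreauEnvelope_eq_zero hf hm zero_lt_one ?_
  obtain ⟨v', h', -⟩ := hf.isProxSubgradient_gradient hm zero_lt_one w
  set h := gradient (moreauEnvelope f 1) w
  have hlim : Tendsto (fun t => (inner ℝ h w - inner ℝ h (x t))
      + ‖h‖ * (γ t * ‖gradient (moreauEnvelope f (γ t)) (x t)‖)
      + ‖gradient (moreauEnvelope f (γ t)) (x t)‖
        * (‖w - h‖ + M + γ t * ‖gradient (moreauEnvelope f (γ t)) (x t)‖)) l (𝓝 0) := by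
    have := (((hw h).const_sub (inner ℝ h w)).add (hγg.const_mul ‖h‖)).add
      (hg.mul (hγg.const_add (‖w - h‖ + M)))
    simpa using this
  have hle : ‖h‖ ^ 2 ≤ 0 := by
    refine ge_of_tendsto hlim ?_
    filter_upwards [hγ, hM] with t ht htM
    obtain ⟨v, h1, -⟩ := hf.isProxSubgradient_gradient hm ht (x t)
    have h2 := h1.inner_sub_nonneg h'
    set g := gradient (moreauEnvelope f (γ t)) (x t)
    have hn : ‖γ t • g‖ = γ t * ‖g‖ := by rw [norm_smul, Real.norm_of_nonneg ht.le]
    have h3 : -inner ℝ g ((w - h) - (x t - γ t • g)) ≤ ‖g‖ * (‖w - h‖ + M + γ t * ‖g‖) := by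
      rw [← inner_neg_right]
      refine (real_inner_le_norm _ _).trans ?_
      rw [norm_neg]
      gcongr
      refine (norm_sub_le _ _).trans ?_
      have := norm_sub_le (x t) (γ t • g)
      linarith
    have h4 : inner ℝ h (γ t • g) ≤ ‖h‖ * (γ t * ‖g‖) := by
      rw [← hn]
      exact real_inner_le_norm _ _
    rw [one_smul, inner_sub_left] at h2
    have h5 : inner ℝ h ((w - h) - (x t - γ t • g))
        = inner ℝ h w - ‖h‖ ^ 2 - inner ℝ h (x t) + inner ℝ h (γ t • g) := by
      rw [inner_sub_right, inner_sub_right, inner_sub_right, real_inner_self_eq_norm_sq]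
      ring
    linarith
  exact norm_eq_zero.1 (pow_eq_zero_iff two_ne_zero |>.1 (le_antisymm hle (sq_nonneg _)))

end WeakConvergence

/-! ### Rates along a solution trajectory -/

section Trajectory

theorem exists_pos_eventually_le_of_liminf_pos {u : ℝ → ℝ}
    (hu : 0 < liminf (fun t => (u t : EReal)) atTop) : ∃ c : ℝ, 0 < c ∧ ∀ᶠ t in atTop, c ≤ u t := by
  obtain ⟨c, hc0, hc⟩ := EReal.lt_iff_exists_real_btwn.1 hu
  refine ⟨c, EReal.coe_pos.1 hc0, ?_⟩
  filter_upwards [eventually_lt_of_lt_liminf hc] with t ht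
  exact (EReal.coe_lt_coe_iff.1 ht).le

theorem integrableOn_Ici_of_continuousOn {u : ℝ → ℝ} {a b : ℝ}
    (hu : ContinuousOn u (Ici a)) (hint : IntegrableOn u (Ioi b)) : IntegrableOn u (Ici a) := by
  have h1 : IntegrableOn u (Icc a b) := (hu.mono Icc_subset_Ici_self).integrableOn_Icc
  refine (h1.union hint).mono_set fun t ht => ?_
  rcases le_or_gt t b with h | h
  · exact Or.inl ⟨ht, h⟩
  · exact Or.inr h

variable {H : Type*} [NormedAddCommGroup H] [InnerProductSpace ℝ H] [CompleteSpace H]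
  {f : H → EReal} {α β t₀ : ℝ} {δ γ : ℝ → ℝ} {x : ℝ → H}

/-- The constants do not depend on the minimizer `z`, so that all minimizers can be treated on the
same time interval. -/
theorem IsSolutionNSHR.exists_isDampedTrajectory (hf : IsProperConvexLsc f)
    (ht₀ : 0 < t₀) (hcoef : CoefficientAssumption α β t₀ δ γ)
    (hx : IsSolutionNSHR f α β t₀ δ γ x) :
    ∃ ζ c T : ℝ, t₀ < T ∧ ∀ z ∈ argminSet f,
      IsDampedTrajectory α β ζ c T δ (derivWithin δ (Ici t₀)) (derivWithin γ (Ici t₀))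
        (fun t => moreauEnvelope f (γ t) (x t) - minValue f) x (derivWithin x (Ici t₀))
        (fun t => gradient (moreauEnvelope f (γ t)) (x t)) z := by
  obtain ⟨ζ, hζ, hζα, hgrowth⟩ := hcoef.growth
  obtain ⟨c, hc, hcle⟩ := exists_pos_eventually_le_of_liminf_pos hcoef.liminf_pos
  obtain ⟨T, hT⟩ := eventually_atTop.1 ((hgrowth.and hcle).and (eventually_gt_atTop t₀))
  have hT₀ : ∀ t, T ≤ t → t₀ < t := fun t ht => (hT t ht).2
  refine ⟨ζ, c, T, hT₀ T le_rfl, fun z hz => ?_⟩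
  have hsub : Ici T ⊆ Ici t₀ := Ici_subset_Ici.2 (hT₀ T le_rfl).le
  have hδ : ∀ t, T ≤ t → 0 < δ t := fun t ht => hcoef.delta_pos t (hT₀ t ht).le
  have hγ : ∀ t, T ≤ t → 0 < γ t := fun t ht => hcoef.gamma_pos t (hT₀ t ht).le
  exact
    { beta_pos := hcoef.beta_pos
      zeta_pos := hζ
      zeta_le := hζα
      c_pos := hc
      start_pos := ht₀.trans (hT₀ T le_rfl)
      delta_pos := hδ
      hasDerivAt_delta := fun t ht =>
        hasDerivAt_derivWithin_of_contDiffOn hcoef.delta_contDiff (hT₀ t ht)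
      hasDerivAt_x := fun t ht => hx.hasDerivAt (hT₀ t ht)
      hasDerivAt_gap := fun t ht => by
        refine (hasDerivAt_moreauEnvelope hf hz
          (hasDerivAt_derivWithin_of_contDiffOn hcoef.gamma_contDiff (hT₀ t ht))
          (hx.hasDerivAt (hT₀ t ht)) ?_).sub_const _
        filter_upwards [Ioi_mem_nhds (hT₀ t ht)] with s hs
        exact hcoef.gamma_pos s (mem_Ici.2 (le_of_lt hs))
      hasDerivAt_velocity_add := fun t ht =>
        hx.hasDerivAt_velocity_add hf hz ht₀ hcoef (hT₀ t ht)
      continuousOn_velocity := hx.continuousOn_velocity.mono hsub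
      continuousOn_gradient := (hx.continuousOn_gradient hf hz hcoef).mono hsub
      gap_nonneg := fun t ht => by
        refine le_trans ?_ (sq_norm_gradient_le_moreauEnvelope_sub hf hz (hγ t ht) (x t))
        have := hγ t ht
        positivity
      gap_le_inner := fun t ht => moreauEnvelope_sub_le_inner hf hz (hγ t ht) (x t)
      delta_growth := fun t ht => by
        obtain ⟨h1, h2⟩ := (hT t ht).1.1
        exact ⟨by simpa [div_mul_cancel₀ _ (hδ t ht).ne'] using
          mul_nonneg h1 (hδ t ht).le, (div_le_iff₀ (hδ t ht)).1 h2⟩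
      le_gamma' := fun t ht => (le_div_iff₀
        (mul_pos (ht₀.trans (hT₀ t ht)) (hδ t ht))).1 (hT t ht).1.2 }

/-- The gap bounds the gradient by `γ/2 ‖∇f_γ(x)‖² ≤ f_γ(x) - f^*`, so the rate of the gap, the
square root and the bound on `t² δ / γ` give the rate of the gradient. -/
theorem tendsto_gradient_of_tendsto_gap {z : H} (hf : IsProperConvexLsc f) (hz : z ∈ argminSet f)
    (hcoef : CoefficientAssumption α β t₀ δ γ)
    (hgap : Tendsto (fun t => t ^ 2 * δ t * (moreauEnvelope f (γ t) (x t) - minValue f))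
      atTop (𝓝 0)) :
    Tendsto (fun t => t ^ 2 * δ t * ‖gradient (moreauEnvelope f (γ t)) (x t)‖) atTop (𝓝 0) := by
  obtain ⟨K, hK⟩ := hcoef.ratio_isBigO.bound
  have h1 : Tendsto (fun t => √(2 * K * (t ^ 2 * δ t
      * (moreauEnvelope f (γ t) (x t) - minValue f)))) atTop (𝓝 0) := by
    simpa using (hgap.const_mul (2 * K)).sqrt
  refine squeeze_zero' ?_ ?_ h1
  · filter_upwards [eventually_ge_atTop t₀] with t ht
    have := hcoef.delta_pos t ht
    positivity
  · filter_upwards [eventually_ge_atTop t₀, eventually_gt_atTop 0, hK] with t ht ht0 hKt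
    have hδ := hcoef.delta_pos t ht
    have hγ := hcoef.gamma_pos t ht
    apply Real.le_sqrt_of_sq_le
    rw [Real.norm_of_nonneg (by positivity), Real.norm_of_nonneg (by positivity), mul_one_div,
      div_le_div_iff₀ hγ ht0] at hKt
    have h2 := sq_norm_gradient_le_moreauEnvelope_sub hf hz hγ (x t)
    set G := ‖gradient (moreauEnvelope f (γ t)) (x t)‖ ^ 2 with hG
    have hG0 : 0 ≤ G := by positivity
    -- `K` bounds a positive quantity divided by a positive one
    have hK0 : 0 ≤ K := by
      by_contra hneg
      have : 0 < t * δ t * t := by positivity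
      nlinarith
    calc (t ^ 2 * δ t * ‖gradient (moreauEnvelope f (γ t)) (x t)‖) ^ 2
        = t ^ 2 * δ t * (t * δ t * t) * G := by rw [hG]; ring
      _ ≤ t ^ 2 * δ t * (K * γ t) * G := by gcongr
      _ = 2 * K * (t ^ 2 * δ t * (γ t / 2 * G)) := by ring
      _ ≤ _ := by gcongr

end Trajectory

theorem mainTheorem1 {H : Type*} [NormedAddCommGroup H] [InnerProductSpace ℝ H] [CompleteSpace H]
    (f : H → EReal) (hf : IsProperConvexLsc f) (hmin : (argminSet f).Nonempty)
    (α β t₀ : ℝ) (ht₀ : 0 < t₀) (δ γ : ℝ → ℝ) (hcoef : CoefficientAssumption α β t₀ δ γ)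
    (x : ℝ → H) (hx : IsSolutionNSHR f α β t₀ δ γ x) :
    ((fun t => moreauEnvelope f (γ t) (x t) - minValue f)
        =o[atTop] fun t => 1 / (t ^ 2 * δ t)) ∧
    ((fun t => ‖gradient (moreauEnvelope f (γ t)) (x t)‖)
        =o[atTop] fun t => 1 / (t ^ 2 * δ t)) ∧
    ((fun t => ‖derivWithin x (Ici t₀) t‖) =o[atTop] fun t => 1 / t) ∧
    IntegrableOn (fun t => t * ‖derivWithin x (Ici t₀) t‖ ^ 2) (Ici t₀) volume ∧
    IntegrableOn
      (fun t => t ^ 3 * δ t ^ 2 * ‖gradient (moreauEnvelope f (γ t)) (x t)‖ ^ 2)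
      (Ici t₀) volume ∧
    (0 < liminf (fun t => ((t ^ 2 * δ t / γ t : ℝ) : EReal)) atTop →
      ∃ xlim ∈ argminSet f,
        Tendsto (fun t => toWeakSpace ℝ H (x t)) atTop (𝓝 (toWeakSpace ℝ H xlim))) := by
  obtain ⟨z, hz⟩ := hmin
  obtain ⟨ζ, c, T, hT, htraj⟩ := hx.exists_isDampedTrajectory hf ht₀ hcoef
  have h := htraj z hz
  have hgap := h.tendsto_gap
  have hgrad := tendsto_gradient_of_tendsto_gap hf hz hcoef hgap
  obtain ⟨T', -, -, hint1, hint2⟩ := h.integrableOn_dissipation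
  have hV := hx.continuousOn_velocity
  have hG := hx.continuousOn_gradient hf hz hcoef
  have hδc := hcoef.delta_contDiff.continuousOn
  have hlittle : ∀ {u r : ℝ → ℝ}, (∀ᶠ t in atTop, 0 < r t) →
      Tendsto (fun t => r t * u t) atTop (𝓝 0) → u =o[atTop] fun t => 1 / r t := by
    intro u r hr hu
    refine (isLittleO_iff_tendsto' ?_).2 (hu.congr fun t => ?_)
    · filter_upwards [hr] with t ht h0
      exact absurd h0 (one_div_pos.2 ht).ne'
    · rw [div_div_eq_mul_div, div_one, mul_comm]
  have hpos : ∀ᶠ t in atTop, 0 < t ^ 2 * δ t := by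
    filter_upwards [eventually_ge_atTop T] with t ht
    have := h.delta_pos t ht
    have := h.start_pos.trans_le ht
    positivity
  refine ⟨hlittle hpos hgap, hlittle hpos hgrad, hlittle (eventually_gt_atTop 0) ?_,
    integrableOn_Ici_of_continuousOn (by fun_prop) hint1,
    integrableOn_Ici_of_continuousOn (by fun_prop) hint2, fun hlim => ?_⟩
  -- `‖ẋ‖ ≤ ‖ẋ + β δ ∇f_γ(x)‖ + β δ ‖∇f_γ(x)‖`, and `t δ ‖∇f_γ(x)‖` is `o(1/t)`
  · have h1 : Tendsto (fun t => t * ‖derivWithin x (Ici t₀) t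
          + β • δ t • gradient (moreauEnvelope f (γ t)) (x t)‖
        + β * (t ^ 2 * δ t * ‖gradient (moreauEnvelope f (γ t)) (x t)‖ / t)) atTop (𝓝 0) := by
      simpa using h.tendsto_velocity_add.add ((hgrad.div_atTop tendsto_id).const_mul β)
    refine squeeze_zero' ?_ ?_ h1
    · filter_upwards [eventually_ge_atTop 0] with t ht
      positivity
    · filter_upwards [eventually_ge_atTop T] with t ht
      have hδ := h.delta_pos t ht
      have ht0 := h.start_pos.trans_le ht
      set g := gradient (moreauEnvelope f (γ t)) (x t)
      have h2 : ‖derivWithin x (Ici t₀) t‖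
          ≤ ‖derivWithin x (Ici t₀) t + β • δ t • g‖ + β * (δ t * ‖g‖) := by
        have := norm_sub_le (derivWithin x (Ici t₀) t + β • δ t • g) (β • δ t • g)
        rwa [add_sub_cancel_right, norm_smul, norm_smul, Real.norm_of_nonneg h.beta_pos.le,
          Real.norm_of_nonneg hδ.le] at this
      calc t * ‖derivWithin x (Ici t₀) t‖
          ≤ t * (‖derivWithin x (Ici t₀) t + β • δ t • g‖ + β * (δ t * ‖g‖)) := by gcongr
        _ = _ := by
          field_simp
  · obtain ⟨b, hb, hble⟩ := exists_pos_eventually_le_of_liminf_pos hlim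
    obtain ⟨M, hM⟩ := h.exists_bound_gap_and_norm_sub
    have hbdd : ∀ᶠ t in atTop, ‖x t‖ ≤ M + ‖z‖ := by
      filter_upwards [hM] with t ht
      have := norm_le_norm_sub_add (x t) z
      linarith [ht.2]
    have hγpos : ∀ᶠ t in atTop, 0 < γ t := by
      filter_upwards [eventually_ge_atTop t₀] with t ht using hcoef.gamma_pos t ht
    -- `δ` is eventually nondecreasing, so `t² δ` is bounded below
    have hg0 : Tendsto (fun t => ‖gradient (moreauEnvelope f (γ t)) (x t)‖) atTop (𝓝 0) := by
      have hd : 0 < T ^ 2 * δ T := by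
        have := h.start_pos
        have := h.delta_pos T le_rfl
        positivity
      refine squeeze_zero' (Eventually.of_forall fun t => norm_nonneg _) ?_
        (by simpa using hgrad.div_const (T ^ 2 * δ T))
      filter_upwards [eventually_ge_atTop T] with t ht
      rw [le_div_iff₀' hd]
      have := h.start_pos
      have := h.delta_pos T le_rfl
      have := h.delta_le ht
      gcongr
    have hγg : Tendsto (fun t => γ t * ‖gradient (moreauEnvelope f (γ t)) (x t)‖)
        atTop (𝓝 0) := by
      refine squeeze_zero' ?_ ?_ (by simpa using hgrad.div_const b)
      · filter_upwards [hγpos] with t ht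
        positivity
      · filter_upwards [hγpos, hble] with t ht hbt
        rw [le_div_iff₀' hb, ← mul_assoc]
        exact mul_le_mul_of_nonneg_right ((le_div_iff₀ ht).1 hbt) (norm_nonneg _)
    exact exists_tendsto_toWeakSpace_of_tendsto_norm_sub ⟨z, hz⟩
      (fun z' hz' => (htraj z' hz').exists_tendsto_norm_sub)
      fun U w hU hw => mem_argminSet_of_tendsto_inner hf (minValue_le hf hz) (hU hγpos) hw
        (hU hbdd) (hg0.mono_left hU) (hγg.mono_left hU)
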